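/- **Setting.** Let $A$ be an order unit space (an archimedean partially ordered real vector space with order unit $1$) that is complete in its order unit norm $\|a\|=\inf\{\lambda\ge 0: -\lambda 1\le a\le\lambda 1\}$, and let $E=\{e\in A: 0\le e\le 1\}$. A *compression with focus* $p\in E$ is a positive linear map $J:A\to A$ with $J(1)=p$ such that for all $e\in E$: $e\le p$ implies $J(e)=e$, and $J(e)=0$ implies $e\le 1-p$. A *compression base* is a family $(J_p)_{p\in P}$ of compressions indexed by their foci such that - $P\subseteq E$ contains $0,1$, is closed under $p\mapsto 1-p$ and under those sums $p+q$ with $p+q\le 1$, and is normal: if $d,e,f\in E$, $d+e+f\le 1$ and $d+e,d+f\in P$, then $d\in P$; - $J_{p+r}\circ J_{q+r}=J_r$ whenever $p,q,r\in P$ and $p+q+r\le 1$. For $p\in P$ let $C(p)=\{a\in A: a=J_p(a)+J_{1-p}(a)\}$; for $S\subseteq A$ let $PC(S)=\{p\in P: S\subseteq C(p)\}$; for $a\in A$ let $P(a)=PC(PC(\{a\})\cup\{a\})$. The base is *spectral* if - (projection cover) for every $e\in E$ there is $p\in P$ such that for all $q\in P$: $e\le q\iff p\le q$; - (comparability) for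 every $a\in A$ there is $p\in P(a)$ with $J_{1-p}(a)\le 0\le J_p(a)$. Elements $p,q\in E$ are compatible if $p=c+p_1$ and $q=c+q_1$ for some $c,p_1,q_1\in E$ with $c+p_1+q_1\in E$. Elements $a,b\in A$ *commute* if all $p\in P(a)$ and $q\in P(b)$ are compatible. For $S\subseteq A$ let $C(S)$ be the set of elements commuting with every element of $S$, and $CC(a)=C(C(\{a\}))$. **Theorem (Borel functional calculus).** Let $(J_p)_{p\in P}$ be a spectral compression base on $A$ and let $a\in A$. Then $CC(a)$ is a linear subspace containing $a$, and there are a totally disconnected compact Hausdorff space $X$ and a unital linear order isomorphism $\Phi:CC(a)\to C(X,\mathbb R)$. The range of $\Phi(a)$ in $\mathbb R$ is the same for all such $X$ and $\Phi$; it is denoted by $sp(a)$. Let $\mathcal B(sp(a))$ be the algebra of bounded Borel functions $sp(a)\to\mathbb R$. There is a positive unital linear map $\Psi_a:\mathcal B(sp(a))\to CC(a)\subseteq A$ such that 1. $\Psi_a(\mathrm{id})=a$, where $\mathrm{id}$ is the function $t\mapsto t$; 2. $\Psi_a(\chi_B)\in P(a)$ for every Borel set $B\subseteq sp(a)$; 3.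 $\Psi_a(\max\{h_1,h_2\})$ is the supremum of $\Psi_a(h_1)$ and $\Psi_a(h_2)$ in $CC(a)$, for all $h_1,h_2\in\mathcal B(sp(a))$; 4. if $(h_n)$ is a nondecreasing sequence in $\mathcal B(sp(a))$ with pointwise supremum $h\in\mathcal B(sp(a))$, then $\Psi_a(h)$ is the supremum of $\{\Psi_a(h_n)\}_n$ in $CC(a)$. -/

import Mathlib

universe u

/-- An order unit space: an archimedean partially ordered real vector space `A` with order unit
`1`, equipped with its order unit norm.  (The order unit norm is determined by the order and the
unit, so the norm is no extra structure.) -/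
class OrderUnitSpace (A : Type*) [NormedAddCommGroup A] [NormedSpace ℝ A] [PartialOrder A]
    [IsOrderedAddMonoid A] [IsOrderedModule ℝ A] [One A] : Prop where
  zero_le_one' : (0 : A) ≤ 1
  exists_le_smul_one : ∀ a : A, ∃ r : ℝ, a ≤ r • (1 : A)
  archimedean : ∀ a b : A, (∀ n : ℕ, n • a ≤ b) → a ≤ 0
  norm_eq : ∀ a : A, ‖a‖ = sInf {r : ℝ | 0 ≤ r ∧ -(r • (1 : A)) ≤ a ∧ a ≤ r • (1 : A)}

/-- The unit interval `E = {e : 0 ≤ e ≤ 1}` (the effects). -/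
def effects (A : Type*) [Zero A] [One A] [LE A] : Set A := {e : A | 0 ≤ e ∧ e ≤ 1}

/-- Mackey compatibility in the effect algebra `E`. -/
def MackeyCompatible {A : Type*} [AddCommGroup A] [PartialOrder A] [One A] (a b : A) : Prop :=
  ∃ c ∈ effects A, ∃ a₁ ∈ effects A, ∃ b₁ ∈ effects A,
    c + a₁ + b₁ ∈ effects A ∧ a = c + a₁ ∧ b = c + b₁

/-- `J` is a compression with focus `p`. -/
structure IsCompression {A : Type*} [AddCommGroup A] [Module ℝ A] [PartialOrder A] [One A]
    (J : A →ₗ[ℝ] A) (p : A) : Prop where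
  positive : ∀ a : A, 0 ≤ a → 0 ≤ J a
  focus_mem : p ∈ effects A
  map_one : J 1 = p
  map_of_le : ∀ e ∈ effects A, e ≤ p → J e = e
  le_of_map_eq_zero : ∀ e ∈ effects A, J e = 0 → e ≤ 1 - p

/-- `P` is a normal subalgebra of the effect algebra `E`. -/
structure IsNormalSubalgebra {A : Type*} [AddCommGroup A] [PartialOrder A] [One A]
    (P : Set A) : Prop where
  subset_effects : P ⊆ effects A
  zero_mem : (0 : A) ∈ P
  one_mem : (1 : A) ∈ P
  compl_mem : ∀ p ∈ P, 1 - p ∈ P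
  add_mem : ∀ p ∈ P, ∀ q ∈ P, p + q ≤ 1 → p + q ∈ P
  normal : ∀ d ∈ effects A, ∀ e ∈ effects A, ∀ f ∈ effects A,
    d + e + f ≤ 1 → d + e ∈ P → d + f ∈ P → d ∈ P

/-- A compression base: a family `(J p)` of compressions indexed by their foci `p ∈ proj`.
(`J` is written as a total function; its values at `p ∉ proj` are never used.) -/
structure CompressionBase (A : Type*) [AddCommGroup A] [Module ℝ A] [PartialOrder A] [One A] where
  proj : Set A
  J : A → A →ₗ[ℝ] A
  normalSubalgebra : IsNormalSubalgebra proj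
  isCompression : ∀ p ∈ proj, IsCompression (J p) p
  comp_eq : ∀ p ∈ proj, ∀ q ∈ proj, ∀ r ∈ proj, p + q + r ≤ 1 →
    J (p + r) ∘ₗ J (q + r) = J r

namespace CompressionBase

section Algebraic

variable {A : Type*} [AddCommGroup A] [Module ℝ A] [PartialOrder A] [One A]

/-- `C(p)`: the elements of `A` commuting with the projection `p`. -/
def projCommutant (b : CompressionBase A) (p : A) : Set A :=
  {a : A | a = b.J p a + b.J (1 - p) a}

/-- `PC(S)`: the projections commuting with all elements of `S`. -/
def PC (b : CompressionBase A) (S : Set A) : Set A :=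
  {p : A | p ∈ b.proj ∧ ∀ a ∈ S, a ∈ b.projCommutant p}

/-- The P-bicommutant `P(a) = PC(PC(a) ∪ {a})`. -/
def projBicommutant (b : CompressionBase A) (a : A) : Set A :=
  b.PC (b.PC {a} ∪ {a})

/-- The projection cover property. -/
def HasProjectionCover (b : CompressionBase A) : Prop :=
  ∀ e ∈ effects A, ∃ p ∈ b.proj, ∀ q ∈ b.proj, e ≤ q ↔ p ≤ q

/-- The comparability property. -/
def HasComparability (b : CompressionBase A) : Prop :=
  ∀ a : A, ∃ p ∈ b.projBicommutant a, b.J (1 - p) a ≤ 0 ∧ 0 ≤ b.J p a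

/-- Spectral compression bases. -/
def IsSpectral (b : CompressionBase A) : Prop :=
  b.HasProjectionCover ∧ b.HasComparability

/-- `a C b'`: every projection in `P(a)` is compatible with every projection in `P(b')`. -/
def Commutes (b : CompressionBase A) (a b' : A) : Prop :=
  ∀ p ∈ b.projBicommutant a, ∀ q ∈ b.projBicommutant b', MackeyCompatible p q

/-- The commutant `C(S)` of a subset `S` of `A`. -/
def commutant (b : CompressionBase A) (S : Set A) : Set A :=
  {b' : A | ∀ a ∈ S, b.Commutes a b'}

/-- The bicommutant `CC(a) = C(C(a))`. -/
def bicommutant (b : CompressionBase A) (a : A) : Set A :=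
  b.commutant (b.commutant {a})

/-- `ι` is (the inverse of) an isomorphism `Φ : CC(a) ≅ C(X, ℝ)` of order unit spaces: it is
linear, unital, an order embedding (in particular injective), and its image is `CC(a)`. -/
structure IsFunctionRep (b : CompressionBase A) (a : A) {X : Type*} [TopologicalSpace X]
    (ι : C(X, ℝ) →ₗ[ℝ] A) : Prop where
  map_one : ι 1 = 1
  le_iff_le : ∀ f g : C(X, ℝ), ι f ≤ ι g ↔ f ≤ g
  range_eq : Set.range ι = b.bicommutant a

end Algebraic

/-- The spectrum of `a`: the range in `ℝ` of the function `f` that corresponds to `a` under an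
isomorphism `CC(a) ≅ C(X, ℝ)`, for `X` a totally disconnected compact Hausdorff space. -/
def spectrum {A : Type u} [AddCommGroup A] [Module ℝ A] [PartialOrder A] [One A]
    (b : CompressionBase A) (a : A) : Set ℝ :=
  {t : ℝ | ∃ (X : Type u) (_ : TopologicalSpace X) (_ : CompactSpace X) (_ : T2Space X)
    (_ : TotallyDisconnectedSpace X) (ι : C(X, ℝ) →ₗ[ℝ] A) (f : C(X, ℝ)),
    b.IsFunctionRep a ι ∧ ι f = a ∧ t ∈ Set.range f}

end CompressionBase

/-- The bounded Borel functions `S → ℝ`. -/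
def boundedBorel (S : Set ℝ) : Subalgebra ℝ (S → ℝ) where
  carrier := {h : S → ℝ | Measurable h ∧ ∃ M : ℝ, ∀ t, |h t| ≤ M}
  mul_mem' := by
    rintro g h ⟨hg, M, hM⟩ ⟨hh, N, hN⟩
    refine ⟨hg.mul hh, M * N, fun t => ?_⟩
    rw [Pi.mul_apply, abs_mul]
    exact mul_le_mul (hM t) (hN t) (abs_nonneg _) ((abs_nonneg _).trans (hM t))
  add_mem' := by
    rintro g h ⟨hg, M, hM⟩ ⟨hh, N, hN⟩
    exact ⟨hg.add hh, M + N, fun t => (abs_add_le _ _).trans (add_le_add (hM t) (hN t))⟩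
  algebraMap_mem' := fun r => ⟨measurable_const, |r|, fun _ => le_rfl⟩

/-- The characteristic function of a Borel set `B ⊆ S`. -/
noncomputable def boundedBorel.char {S : Set ℝ} (B : Set S) (hB : MeasurableSet B) :
    boundedBorel S :=
  ⟨B.indicator (fun _ => (1 : ℝ)), measurable_const.indicator hB, 1, fun t => by
    by_cases ht : t ∈ B <;> simp [ht]⟩

/-- The pointwise maximum of two bounded Borel functions. -/
noncomputable def boundedBorel.max {S : Set ℝ} (g h : boundedBorel S) : boundedBorel S :=
  ⟨fun t => Max.max (g.1 t) (h.1 t), g.2.1.max h.2.1, by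
    obtain ⟨M, hM⟩ := g.2.2
    obtain ⟨N, hN⟩ := h.2.2
    exact ⟨Max.max M N, fun t => abs_max_le_max_abs_abs.trans (max_le_max (hM t) (hN t))⟩⟩

/-!
The projections in `P(a)` act on `CC(a)` through the compressions `J p` as band projections, and by
comparability every element of `CC(a)` is split by one of them into its positive and negative part.
A band projection `T` satisfies `φ (T x) = φ (T 1) * φ x` for every pure state `φ`, so this
multiplicativity defines a compact space of characters on which `CC(a)` is represented by
all continuous functions (Krein-Milman for the order, Stone-Weierstrass for surjectivity).

For the Borel calculus, projection covers provide countable suprema of projections of `P(a)`.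
A supremum in `C(X, ℝ)` is a pointwise supremum off a meagre set, so the sets that agree up to a
meagre set with the clopen set of a projection in `P(a)` form a σ-algebra. The function `f`
representing `a` is measurable for it, whence `h ∘ f` agrees off a meagre set with a
continuous function for every bounded Borel `h`; that function represents `h(a)`.
-/

open Filter Topology

section Residual

variable {X : Type*} [TopologicalSpace X]

theorem continuousMap_le_of_eventually_residual [BaireSpace X] {f g : C(X, ℝ)}
    (h : ∀ᶠ x in residual X, f x ≤ g x) : f ≤ g := fun x =>
  (isClosed_le f.continuous g.continuous).closure_subset (dense_of_mem_residual h x)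

theorem continuousMap_eq_of_eventuallyEq_residual [BaireSpace X] {f g : C(X, ℝ)}
    (h : f =ᶠ[residual X] g) : f = g :=
  le_antisymm (continuousMap_le_of_eventually_residual h.le)
    (continuousMap_le_of_eventually_residual h.symm.le)

theorem dense_biUnion_sub_lt [CompletelyRegularSpace X] {S : Set C(X, ℝ)} {k : C(X, ℝ)}
    (hk : IsLUB S k) {δ : ℝ} (hδ : 0 < δ) : Dense (⋃ g ∈ S, {x | k x - δ < g x}) := by
  set U := ⋃ g ∈ S, {x | k x - δ < g x}
  intro x
  by_contra hx
  obtain ⟨f, hf, hfx, hf1⟩ := CompletelyRegularSpace.completely_regular x _ isClosed_closure hx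
  -- `k` could be lowered by a bump at `x` that vanishes on `U`
  let bump : C(X, ℝ) := ⟨fun y => δ * (1 - f y), by fun_prop⟩
  have hub : k - bump ∈ upperBounds S := fun g hg y => by
    change g y ≤ k y - δ * (1 - f y)
    by_cases hy : y ∈ U
    · simpa [hf1 (subset_closure hy)] using hk.1 hg y
    · have : g y ≤ k y - δ := by
        by_contra! h
        exact hy (Set.mem_biUnion hg h)
      nlinarith [(f y).2.1]
  have : k x ≤ k x - δ * (1 - f x) := hk.2 hub x
  simp only [hfx, Set.Icc.coe_zero, sub_zero, mul_one] at this
  linarith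

theorem isLUB_continuousMap_iff [BaireSpace X] [CompletelyRegularSpace X] {S : Set C(X, ℝ)}
    {k : C(X, ℝ)} :
    IsLUB S k ↔ ∀ᶠ x in residual X, IsLUB ((fun g : C(X, ℝ) => g x) '' S) (k x) := by
  refine ⟨fun hk => ?_, fun h => ⟨fun g hg => ?_, fun u hu => ?_⟩⟩
  · have hres : ∀ᶠ x in residual X, ∀ n : ℕ, ∃ g ∈ S, k x - 1 / (n + 1) < g x := by
      refine eventually_countable_forall.2 fun n => ?_
      filter_upwards [residual_of_dense_open
        (isOpen_biUnion fun g _ => isOpen_lt (by fun_prop) g.continuous)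
        (dense_biUnion_sub_lt hk (Nat.one_div_pos_of_nat (n := n)))] with x hx
      simpa using hx
    filter_upwards [hres] with x hx
    refine ⟨Set.forall_mem_image.2 fun g hg => hk.1 hg x, fun c hc => ?_⟩
    refine le_of_forall_pos_le_add fun ε hε => ?_
    obtain ⟨n, hn⟩ := exists_nat_one_div_lt hε
    obtain ⟨g, hg, hgx⟩ := hx n
    linarith [hc (Set.mem_image_of_mem _ hg)]
  · exact continuousMap_le_of_eventually_residual
      (h.mono fun x hx => hx.1 (Set.mem_image_of_mem _ hg))
  · exact continuousMap_le_of_eventually_residual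
      (h.mono fun x hx => hx.2 (Set.forall_mem_image.2 fun g hg => hu hg x))

variable (X) in
/-- The functions that agree with a continuous function off a meagre set. -/
def residuallyContinuous : Submodule ℝ (X → ℝ) where
  carrier := {u | ∃ g : C(X, ℝ), g =ᶠ[residual X] u}
  add_mem' := fun ⟨g, hg⟩ ⟨h, hh⟩ => ⟨g + h, hg.add hh⟩
  zero_mem' := ⟨0, EventuallyEq.rfl⟩
  smul_mem' := fun c _ ⟨g, hg⟩ => ⟨c • g, hg.const_smul c⟩

/-- The continuous representative of a residually continuous function; by Baire's theorem it is
unique. -/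
noncomputable def residualRep [BaireSpace X] : residuallyContinuous X →ₗ[ℝ] C(X, ℝ) where
  toFun u := u.2.choose
  map_add' u v := continuousMap_eq_of_eventuallyEq_residual <|
    (u + v).2.choose_spec.trans (u.2.choose_spec.add v.2.choose_spec).symm
  map_smul' c u := continuousMap_eq_of_eventuallyEq_residual <|
    (c • u).2.choose_spec.trans (u.2.choose_spec.const_smul c).symm

theorem residualRep_eventuallyEq [BaireSpace X] (u : residuallyContinuous X) :
    residualRep u =ᶠ[residual X] u.1 :=
  u.2.choose_spec

theorem residualRep_eq_of_eventuallyEq [BaireSpace X] {u : residuallyContinuous X} {g : C(X, ℝ)}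
    (h : g =ᶠ[residual X] u.1) : residualRep u = g :=
  continuousMap_eq_of_eventuallyEq_residual ((residualRep_eventuallyEq u).trans h.symm)

theorem isLUB_residualRep [BaireSpace X] [CompletelyRegularSpace X]
    {S : Set (residuallyContinuous X)} (hS : S.Countable) {u : residuallyContinuous X}
    (hu : ∀ x, IsLUB ((fun v : residuallyContinuous X => v.1 x) '' S) (u.1 x)) :
    IsLUB (residualRep '' S) (residualRep u) := by
  refine isLUB_continuousMap_iff.2 ?_
  have hrep : ∀ᶠ x in residual X, ∀ v ∈ S, residualRep v x = v.1 x :=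
    (eventually_countable_ball hS).2 fun v _ => residualRep_eventuallyEq v
  filter_upwards [hrep, residualRep_eventuallyEq u] with x hx hux
  rw [Set.image_image, Set.image_congr hx, hux]
  exact hu x

theorem mem_residuallyContinuous_of_approx [CompactSpace X] [BaireSpace X] {u : X → ℝ}
    (h : ∀ ε > 0, ∃ v ∈ residuallyContinuous X, ∀ x, |v x - u x| ≤ ε) :
    u ∈ residuallyContinuous X := by
  choose v hv hvu using fun n : ℕ => h (1 / (n + 1)) Nat.one_div_pos_of_nat
  choose G hG using hv
  have hGu : ∀ᶠ x in residual X, ∀ n : ℕ, |G n x - u x| ≤ 1 / (n + 1) :=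
    eventually_countable_forall.2 fun n => (hG n).mono fun x hx => hx ▸ hvu n x
  have hdist : ∀ n m N : ℕ, N ≤ n → N ≤ m → dist (G n) (G m) ≤ 2 * (1 / (N + 1)) := by
    intro n m N hn hm
    have hres : ∀ᶠ x in residual X, |G n x - G m x| ≤ 2 * (1 / (N + 1)) := by
      filter_upwards [hGu] with x hx
      have := abs_sub_le (G n x) (u x) (G m x)
      rw [abs_sub_comm (u x)] at this
      linarith [hx n, hx m, Nat.one_div_le_one_div (α := ℝ) hn,
        Nat.one_div_le_one_div (α := ℝ) hm]
    refine (ContinuousMap.dist_le (by positivity)).2 ?_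
    exact continuousMap_le_of_eventually_residual (f := |G n - G m|)
      (g := .const X (2 * (1 / (N + 1)))) hres
  obtain ⟨g, hg⟩ := cauchySeq_tendsto_of_complete
    (cauchySeq_of_le_tendsto_0 _ hdist
      (by simpa using tendsto_one_div_add_atTop_nhds_zero_nat.const_mul (2 : ℝ)))
  refine ⟨g, ?_⟩
  filter_upwards [hGu] with x hx
  refine tendsto_nhds_unique (((continuous_eval_const x).tendsto g).comp hg) ?_
  exact tendsto_iff_dist_tendsto_zero.2 <|
    squeeze_zero (fun _ => dist_nonneg) hx tendsto_one_div_add_atTop_nhds_zero_nat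

theorem simpleFunc_mem_residuallyContinuous [MeasurableSpace X]
    (h : ∀ E : Set X, MeasurableSet E → E.indicator 1 ∈ residuallyContinuous X)
    (s : MeasureTheory.SimpleFunc X ℝ) : ⇑s ∈ residuallyContinuous X := by
  induction s using MeasureTheory.SimpleFunc.induction with
  | @const c E hE =>
    convert (residuallyContinuous X).smul_mem c (h _ hE) using 1
    ext x
    by_cases hx : x ∈ E <;> simp [hx]
  | add _ hf hg => exact (residuallyContinuous X).add_mem hf hg

theorem mem_residuallyContinuous_of_measurable [CompactSpace X] [BaireSpace X] [MeasurableSpace X]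
    (h : ∀ E : Set X, MeasurableSet E → E.indicator 1 ∈ residuallyContinuous X)
    {u : X → ℝ} (hu : Measurable u) {M : ℝ} (hM : ∀ x, |u x| ≤ M) :
    u ∈ residuallyContinuous X := by
  refine mem_residuallyContinuous_of_approx fun ε hε => ?_
  let s : MeasureTheory.SimpleFunc X ℝ :=
    { toFun := fun x => ε * ⌊u x / ε⌋
      measurableSet_fiber' := fun c =>
        ((measurable_from_top (f := fun n : ℤ => ε * (n : ℝ))).comp
          (hu.div_const ε).floor) (measurableSet_singleton c)
      finite_range' := by
        refine ((Set.finite_Icc ⌊-M / ε⌋ ⌊M / ε⌋).image fun n : ℤ => ε * (n : ℝ)).subset ?_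
        rintro _ ⟨x, rfl⟩
        refine ⟨_, ⟨Int.floor_le_floor ?_, Int.floor_le_floor ?_⟩, rfl⟩ <;>
          exact div_le_div_of_nonneg_right (by linarith [abs_le.1 (hM x)]) hε.le }
  refine ⟨s, simpleFunc_mem_residuallyContinuous h s, fun x => ?_⟩
  have h₁ := (le_div_iff₀ hε).1 (Int.floor_le (u x / ε))
  have h₂ := (div_lt_iff₀ hε).1 (Int.lt_floor_add_one (u x / ε))
  change |ε * ⌊u x / ε⌋ - u x| ≤ ε
  rw [abs_le]
  constructor <;> linarith

end Residual

theorem mem_range_continuousMap_iff {X : Type*} [TopologicalSpace X] [CompactSpace X] (f : C(X, ℝ))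
    (t : ℝ) : t ∈ Set.range f ↔
      ∀ ε > (0 : ℝ), ∃ g, f - t • 1 ≤ g ∧ t • 1 - f ≤ g ∧ ¬ ε • (1 : C(X, ℝ)) ≤ g := by
  refine ⟨?_, fun h => ?_⟩
  · rintro ⟨x, rfl⟩ ε hε
    refine ⟨|f - f x • 1|, le_abs_self _, neg_sub f (f x • 1) ▸ neg_le_abs _, fun h => ?_⟩
    have hx : ε * 1 ≤ |f x - f x * 1| := h x
    simp only [mul_one, sub_self, abs_zero] at hx
    exact hε.not_ge hx
  · by_contra ht
    obtain ⟨ε, hε, hball⟩ :=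
      Metric.isOpen_iff.1 (isCompact_range f.continuous).isClosed.isOpen_compl t ht
    obtain ⟨g, h₁, h₂, hg⟩ := h ε hε
    refine hg fun x => ?_
    have hfx : ε ≤ |f x - t| := by
      by_contra! hlt
      exact hball (Metric.mem_ball.2 hlt) ⟨x, rfl⟩
    have h₁x : f x - t * 1 ≤ g x := h₁ x
    have h₂x : t * 1 - f x ≤ g x := h₂ x
    change ε * 1 ≤ g x
    cases abs_cases (f x - t) <;> linarith

namespace OrderUnitSpace

section Norm

variable {V : Type*} [NormedAddCommGroup V] [NormedSpace ℝ V] [PartialOrder V]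
  [IsOrderedAddMonoid V] [IsOrderedModule ℝ V] [One V] [OrderUnitSpace V]

theorem smul_one_mono {r s : ℝ} (h : r ≤ s) : r • (1 : V) ≤ s • (1 : V) :=
  smul_le_smul_of_nonneg_right h zero_le_one'

theorem le_of_forall_pos_le_add_smul_one {x y : V} (h : ∀ ε : ℝ, 0 < ε → x ≤ y + ε • (1 : V)) :
    x ≤ y := by
  rw [← sub_nonpos]
  refine archimedean (x - y) 1 fun n => ?_
  rcases Nat.eq_zero_or_pos n with rfl | hn
  · simpa using zero_le_one' (A := V)
  have hn' : (0 : ℝ) < n := by exact_mod_cast hn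
  have h₁ : x - y ≤ (n : ℝ)⁻¹ • (1 : V) := sub_le_iff_le_add'.2 (h _ (inv_pos.2 hn'))
  simpa [smul_smul, hn'.ne', Nat.cast_smul_eq_nsmul] using smul_le_smul_of_nonneg_left h₁ hn'.le

theorem exists_bound (x : V) : ∃ r : ℝ, 0 ≤ r ∧ -(r • (1 : V)) ≤ x ∧ x ≤ r • (1 : V) := by
  obtain ⟨r, hr⟩ := exists_le_smul_one x
  obtain ⟨s, hs⟩ := exists_le_smul_one (-x)
  refine ⟨max 0 (max r s), le_max_left _ _, neg_le.1 (hs.trans (smul_one_mono ?_)),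
    hr.trans (smul_one_mono ?_)⟩ <;> simp

theorem le_norm_smul_one (x : V) : x ≤ ‖x‖ • (1 : V) := by
  refine le_of_forall_pos_le_add_smul_one fun ε hε => ?_
  have hlt : sInf {r : ℝ | 0 ≤ r ∧ -(r • (1 : V)) ≤ x ∧ x ≤ r • (1 : V)} < ‖x‖ + ε := by
    rw [← norm_eq]
    linarith
  obtain ⟨r, hr, hrε⟩ := exists_lt_of_csInf_lt (exists_bound x) hlt
  rw [← add_smul]
  exact hr.2.2.trans (smul_one_mono hrε.le)

theorem neg_norm_smul_one_le (x : V) : -(‖x‖ • (1 : V)) ≤ x := by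
  simpa [neg_le] using le_norm_smul_one (-x)

theorem norm_le_of_bounds {x : V} {r : ℝ} (hr : 0 ≤ r) (h₁ : -(r • (1 : V)) ≤ x)
    (h₂ : x ≤ r • (1 : V)) : ‖x‖ ≤ r := by
  rw [norm_eq]
  exact csInf_le ⟨0, fun _ h => h.1⟩ ⟨hr, h₁, h₂⟩

theorem norm_one_le : ‖(1 : V)‖ ≤ 1 :=
  norm_le_of_bounds zero_le_one (by simpa using neg_nonpos.2 zero_le_one' |>.trans zero_le_one')
    (by simp)

theorem norm_norm_smul_one_sub_le_iff {x : V} : ‖‖x‖ • (1 : V) - x‖ ≤ ‖x‖ ↔ 0 ≤ x := by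
  refine ⟨fun h => ?_, fun h => norm_le_of_bounds (norm_nonneg _) ?_ (sub_le_self _ h)⟩
  · have := (le_norm_smul_one (‖x‖ • (1 : V) - x)).trans (smul_one_mono h)
    simpa using this
  · exact (neg_nonpos.2 (smul_nonneg (norm_nonneg _) zero_le_one')).trans
      (sub_nonneg.2 (le_norm_smul_one x))

instance : OrderClosedTopology V where
  isClosed_le' := by
    have hnonneg : IsClosed {x : V | 0 ≤ x} := by
      simp only [← norm_norm_smul_one_sub_le_iff]
      exact isClosed_le (by fun_prop) (by fun_prop)
    simpa only [Set.preimage, Set.mem_ofPred_eq, sub_nonneg] using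
      hnonneg.preimage (f := fun p : V × V => p.2 - p.1) (by fun_prop)

theorem continuous_of_nonneg {T : V →ₗ[ℝ] V} (hT : ∀ x, 0 ≤ x → 0 ≤ T x) : Continuous T := by
  have hmono : ∀ x y, x ≤ y → T x ≤ T y := fun x y h => by
    simpa using hT (y - x) (sub_nonneg.2 h)
  refine AddMonoidHomClass.continuous_of_bound T ‖T 1‖ fun x => ?_
  have h₁ : ‖x‖ • T 1 ≤ (‖T 1‖ * ‖x‖) • (1 : V) := by
    rw [mul_comm, mul_smul]
    exact smul_le_smul_of_nonneg_left (le_norm_smul_one _) (norm_nonneg x)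
  refine norm_le_of_bounds (by positivity) ((neg_le_neg h₁).trans ?_) (le_trans ?_ h₁)
  · simpa using hmono _ _ (neg_norm_smul_one_le x)
  · simpa using hmono _ _ (le_norm_smul_one x)

theorem abs_apply_le {φ : V →ₗ[ℝ] ℝ} (hφ : ∀ x, 0 ≤ x → 0 ≤ φ x) (x : V) :
    |φ x| ≤ ‖x‖ * φ 1 := by
  have h₁ := hφ _ (sub_nonneg.2 (le_norm_smul_one x))
  have h₂ := hφ _ (sub_nonneg.2 (neg_norm_smul_one_le x))
  simp only [map_sub, map_neg, map_smul, smul_eq_mul] at h₁ h₂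
  exact abs_le.2 ⟨by linarith, by linarith⟩

end Norm

section States

variable (V : Type*) [NormedAddCommGroup V] [NormedSpace ℝ V] [PartialOrder V] [One V]

/-- The state space of an order unit space, with the weak* topology. -/
def states : Set (WeakDual ℝ V) :=
  {φ | φ 1 = 1 ∧ ∀ x : V, 0 ≤ x → 0 ≤ φ x}

theorem isClosed_states : IsClosed (states V) := by
  have h : states V = {φ | φ 1 = 1} ∩ ⋂ x ∈ {x : V | 0 ≤ x}, {φ | 0 ≤ φ x} := by
    ext
    simp [states]
  rw [h]
  exact (isClosed_eq (WeakDual.eval_continuous 1) continuous_const).inter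
    (isClosed_biInter fun x _ => isClosed_le continuous_const (WeakDual.eval_continuous x))

variable {V} [IsOrderedAddMonoid V] [IsOrderedModule ℝ V] [OrderUnitSpace V]

theorem abs_state_apply_le {φ : WeakDual ℝ V} (hφ : φ ∈ states V) (x : V) : |φ x| ≤ ‖x‖ := by
  simpa [hφ.1] using abs_apply_le (φ := (φ : V →ₗ[ℝ] ℝ)) hφ.2 x

theorem isCompact_states : IsCompact (states V) := by
  refine (WeakDual.isCompact_closedBall (𝕜 := ℝ) (E := V) 0 1).of_isClosed_subset
    (isClosed_states V) fun φ hφ => ?_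
  simp only [Set.mem_preimage, mem_closedBall_zero_iff]
  exact ContinuousLinearMap.opNorm_le_bound _ zero_le_one fun x => by
    simpa using abs_state_apply_le hφ x

theorem exists_state_apply_eq_norm {q : V} (hq : 0 ≤ q) (hq0 : q ≠ 0) :
    ∃ φ ∈ states V, φ q = ‖q‖ := by
  obtain ⟨g, hg, hgq⟩ := exists_dual_vector ℝ q (norm_ne_zero_iff.2 hq0)
  have hle : ∀ x : V, g x ≤ ‖x‖ := fun x =>
    (le_abs_self _).trans (by simpa [hg] using g.le_opNorm x)
  have h₁ : g 1 = 1 := by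
    refine le_antisymm ((hle 1).trans norm_one_le) ?_
    have hnorm : ‖(2 : ℝ) • q - ‖q‖ • (1 : V)‖ ≤ ‖q‖ := by
      refine norm_le_of_bounds (norm_nonneg _) ?_ ?_
      · simpa using smul_nonneg zero_le_two hq
      · rw [two_smul, sub_le_iff_le_add]
        exact add_le_add (le_norm_smul_one q) (le_norm_smul_one q)
    have := (hle _).trans hnorm
    simp only [map_sub, map_smul, smul_eq_mul, hgq, RCLike.ofReal_real_eq_id, id_eq] at this
    nlinarith [norm_pos_iff.2 hq0]
  refine ⟨g, ⟨h₁, fun x hx => ?_⟩, hgq⟩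
  have := (hle _).trans (norm_norm_smul_one_sub_le_iff.2 hx)
  simp only [map_sub, map_smul, smul_eq_mul, h₁] at this
  change 0 ≤ g x
  linarith

theorem isExtreme_states_apply_eq_norm (q : V) :
    IsExtreme ℝ (states V) {φ ∈ states V | φ q = ‖q‖} := by
  refine ⟨Set.sep_subset _ _, fun φ hφ ψ hψ χ hχ hmem => ⟨hφ, ?_⟩⟩
  obtain ⟨s, t, hs, ht, hst, rfl⟩ := hmem
  have h₁ := (le_abs_self _).trans (abs_state_apply_le hφ q)
  have h₂ := (le_abs_self _).trans (abs_state_apply_le hψ q)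
  have h₃ : s * φ q + t * ψ q = (s + t) * ‖q‖ := by
    rw [hst, one_mul]
    exact hχ.2
  nlinarith [mul_le_mul_of_nonneg_left h₂ ht.le]

instance : LocallyConvexSpace ℝ (WeakDual ℝ V) :=
  inferInstanceAs (LocallyConvexSpace ℝ (WeakBilin (topDualPairing ℝ V)))

theorem exists_extremePoint_apply_eq_norm {q : V} (hq : 0 ≤ q) (hq0 : q ≠ 0) :
    ∃ φ ∈ (states V).extremePoints ℝ, φ q = ‖q‖ := by
  have hcompact : IsCompact {φ ∈ states V | φ q = ‖q‖} :=
    isCompact_states.inter_right (isClosed_eq (WeakDual.eval_continuous q) continuous_const)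
  obtain ⟨φ, hφ⟩ := hcompact.extremePoints_nonempty (exists_state_apply_eq_norm hq hq0)
  exact ⟨φ, (isExtreme_states_apply_eq_norm q).extremePoints_subset_extremePoints hφ, hφ.1.2⟩

theorem apply_eq_mul_of_mem_extremePoints {φ : WeakDual ℝ V}
    (hφ : φ ∈ (states V).extremePoints ℝ) {ψ : WeakDual ℝ V} (hψ : ∀ x, 0 ≤ x → 0 ≤ ψ x)
    (hψφ : ∀ x, 0 ≤ x → ψ x ≤ φ x) (x : V) : ψ x = ψ 1 * φ x := by
  have hcompl : ∀ x, 0 ≤ x → 0 ≤ (φ - ψ) x := fun x hx => sub_nonneg.2 (hψφ x hx)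
  have hle : |ψ x| ≤ ‖x‖ * ψ 1 := abs_apply_le (φ := (ψ : V →ₗ[ℝ] ℝ)) hψ x
  have hle' : |φ x - ψ x| ≤ ‖x‖ * (φ 1 - ψ 1) :=
    abs_apply_le (φ := ((φ - ψ : WeakDual ℝ V) : V →ₗ[ℝ] ℝ)) hcompl x
  rw [hφ.1.1] at hle'
  rcases (hψ 1 zero_le_one').eq_or_lt with h0 | h0
  · simpa [← h0] using hle
  rcases (hφ.1.1 ▸ hψφ 1 zero_le_one' : ψ 1 ≤ 1).eq_or_lt with h1 | h1
  · have : φ x - ψ x = 0 := by simpa [h1] using hle'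
    rw [h1]
    linarith
  -- otherwise `φ` is a proper convex combination of the normalizations of `ψ` and `φ - ψ`
  have hseg : φ ∈ openSegment ℝ ((ψ 1)⁻¹ • ψ) ((1 - ψ 1)⁻¹ • (φ - ψ)) := by
    refine ⟨ψ 1, 1 - ψ 1, h0, sub_pos.2 h1, by ring, ?_⟩
    rw [smul_inv_smul₀ h0.ne', smul_inv_smul₀ (sub_pos.2 h1).ne', add_sub_cancel]
  have heq := hφ.2 ⟨inv_mul_cancel₀ h0.ne', fun y hy => mul_nonneg (inv_pos.2 h0).le (hψ y hy)⟩
    ⟨?_, fun y hy => mul_nonneg (inv_pos.2 (sub_pos.2 h1)).le (hcompl y hy)⟩ hseg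
  · rw [← heq]
    exact (mul_inv_cancel_left₀ h0.ne' (ψ x)).symm
  · change (1 - ψ 1)⁻¹ * (φ 1 - ψ 1) = 1
    rw [hφ.1.1, inv_mul_cancel₀ (sub_pos.2 h1).ne']

end States

section Characters

/-- An order projection that splits its domain into two order direct summands, as the band
projections of a Riesz space do. -/
structure IsBandProjection {V : Type*} [AddCommGroup V] [Module ℝ V] [PartialOrder V]
    (T : V →ₗ[ℝ] V) : Prop where
  nonneg : ∀ x, 0 ≤ x → 0 ≤ T x
  le_self : ∀ x, 0 ≤ x → T x ≤ x
  idempotent : ∀ x, T (T x) = T x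

/-- Every element is positive on one band and negative on the complementary one. -/
def HasBandComparability (V : Type*) [AddCommGroup V] [Module ℝ V] [PartialOrder V] : Prop :=
  ∀ x : V, ∃ T : V →ₗ[ℝ] V, IsBandProjection T ∧ 0 ≤ T x ∧ x ≤ T x

variable (V : Type*) [NormedAddCommGroup V] [NormedSpace ℝ V] [PartialOrder V] [One V]

/-- The states under which every band projection `T` acts as multiplication by the value at
`T 1`; they are the points of the representation space of `V`. -/
def characters : Set (WeakDual ℝ V) :=
  {φ ∈ states V | ∀ T : V →ₗ[ℝ] V, IsBandProjection T → ∀ x, φ (T x) = φ (T 1) * φ x}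

theorem isClosed_characters : IsClosed (characters V) := by
  have h : characters V = states V ∩
      ⋂ T ∈ {T : V →ₗ[ℝ] V | IsBandProjection T}, ⋂ x, {φ | φ (T x) = φ (T 1) * φ x} := by
    ext
    simp [characters]
  rw [h]
  exact (isClosed_states V).inter (isClosed_biInter fun T _ => isClosed_iInter fun x =>
    isClosed_eq (WeakDual.eval_continuous _)
      ((WeakDual.eval_continuous _).mul (WeakDual.eval_continuous _)))

/-- The evaluation of elements of `V` at the characters. -/
noncomputable def gelfand : V →ₗ[ℝ] C(characters V, ℝ) where
  toFun x := ⟨fun φ => φ.1 x, (WeakDual.eval_continuous x).comp continuous_subtype_val⟩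
  map_add' x y := by ext φ; exact map_add φ.1 x y
  map_smul' c x := by ext φ; exact map_smul φ.1 c x

variable {V}

@[simp]
theorem gelfand_apply (x : V) (φ : characters V) : gelfand V x φ = φ.1 x := rfl

theorem gelfand_one : gelfand V 1 = 1 := by
  ext φ
  exact φ.2.1.1

theorem gelfand_bandProjection {T : V →ₗ[ℝ] V} (hT : IsBandProjection T) (x : V) :
    gelfand V (T x) = gelfand V (T 1) * gelfand V x := by
  ext φ
  exact φ.2.2 T hT x

theorem gelfand_bandProjection_one_eq_zero_or_one {T : V →ₗ[ℝ] V} (hT : IsBandProjection T)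
    (φ : characters V) : gelfand V (T 1) φ = 0 ∨ gelfand V (T 1) φ = 1 := by
  have h : gelfand V (T 1) φ * gelfand V (T 1) φ = gelfand V (T 1) φ := by
    rw [← ContinuousMap.mul_apply, ← gelfand_bandProjection hT, hT.idempotent]
  exact (eq_zero_or_one_of_sq_eq_self (by rwa [sq]))

variable (V) in
/-- The algebra of functions on the characters generated by the images of the bands; it is
dense by the Stone-Weierstrass theorem. -/
noncomputable def bandSubalgebra : Subalgebra ℝ C(characters V, ℝ) :=
  Algebra.adjoin ℝ {f | ∃ T, IsBandProjection T ∧ f = gelfand V (T 1)}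

theorem mul_mem_range_gelfand {f g : C(characters V, ℝ)} (hf : f ∈ bandSubalgebra V)
    (hg : g ∈ LinearMap.range (gelfand V)) : f * g ∈ LinearMap.range (gelfand V) := by
  rw [bandSubalgebra] at hf
  induction hf using Algebra.adjoin_induction generalizing g with
  | mem f hf =>
    obtain ⟨T, hT, rfl⟩ := hf
    obtain ⟨x, rfl⟩ := hg
    exact ⟨T x, gelfand_bandProjection hT x⟩
  | algebraMap r =>
    rw [← Algebra.smul_def]
    exact Submodule.smul_mem _ r hg
  | add f₁ f₂ _ _ h₁ h₂ =>
    rw [add_mul]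
    exact Submodule.add_mem _ (h₁ hg) (h₂ hg)
  | mul f₁ f₂ _ _ h₁ h₂ =>
    rw [mul_assoc]
    exact h₁ (h₂ hg)

variable [IsOrderedAddMonoid V]

theorem gelfand_mono {x y : V} (h : x ≤ y) :
    gelfand V x ≤ gelfand V y := fun φ => by
  simpa using φ.2.1.2 _ (sub_nonneg.2 h)

theorem exists_bandProjection_separating (hV : HasBandComparability V) (x : V) (t : ℝ) :
    ∃ T : V →ₗ[ℝ] V, IsBandProjection T ∧ ∀ φ : characters V,
      (φ.1 x < t → gelfand V (T 1) φ = 0) ∧ (t < φ.1 x → gelfand V (T 1) φ = 1) := by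
  obtain ⟨T, hT, hpos, hle⟩ := hV (x - t • 1)
  refine ⟨T, hT, fun φ => ?_⟩
  have hTx : φ.1 (T (x - t • 1)) = gelfand V (T 1) φ * (φ.1 x - t) := by
    rw [φ.2.2 T hT, map_sub, map_smul, φ.2.1.1, smul_eq_mul, mul_one, gelfand_apply]
  have h₁ : 0 ≤ gelfand V (T 1) φ * (φ.1 x - t) := hTx ▸ φ.2.1.2 _ hpos
  have h₂ : φ.1 x - t ≤ gelfand V (T 1) φ * (φ.1 x - t) := by
    rw [← hTx]
    simpa [φ.2.1.1] using gelfand_mono hle φ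
  rcases gelfand_bandProjection_one_eq_zero_or_one hT φ with h | h
  all_goals
    rw [h] at h₁ h₂ ⊢
    constructor <;> intro hlt <;> linarith

theorem exists_bandProjection_eq_zero_and_eq_one (hV : HasBandComparability V)
    {φ ψ : characters V} (hne : φ ≠ ψ) : ∃ T : V →ₗ[ℝ] V, IsBandProjection T ∧
      gelfand V (T 1) φ = 0 ∧ gelfand V (T 1) ψ = 1 := by
  obtain ⟨x, hx⟩ : ∃ x, φ.1 x < ψ.1 x := by
    by_contra! h
    refine hne (Subtype.ext (DFunLike.ext _ _ fun x => le_antisymm ?_ (h x)))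
    simpa using h (-x)
  obtain ⟨t, hφ, hψ⟩ := exists_between hx
  obtain ⟨T, hT, hsep⟩ := exists_bandProjection_separating hV x t
  exact ⟨T, hT, (hsep φ).1 hφ, (hsep ψ).2 hψ⟩

theorem totallyDisconnectedSpace_characters (hV : HasBandComparability V) :
    TotallyDisconnectedSpace (characters V) := by
  suffices TotallySeparatedSpace (characters V) from inferInstance
  refine totallySeparatedSpace_iff_exists_isClopen.2 fun φ ψ hne => ?_
  obtain ⟨T, hT, hφ, hψ⟩ := exists_bandProjection_eq_zero_and_eq_one hV hne
  have hcompl : {χ | gelfand V (T 1) χ = 0}ᶜ = {χ | gelfand V (T 1) χ = 1} := by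
    ext χ
    rcases gelfand_bandProjection_one_eq_zero_or_one hT χ with h | h <;>
      simp [-gelfand_apply, h]
  refine ⟨{χ | gelfand V (T 1) χ = 0}, ⟨isClosed_eq (map_continuous _) continuous_const,
    isClosed_compl_iff.1 ?_⟩, hφ, by simp [-gelfand_apply, hψ]⟩
  rw [hcompl]
  exact isClosed_eq (map_continuous _) continuous_const

theorem bandSubalgebra_separatesPoints (hV : HasBandComparability V) :
    (bandSubalgebra V).SeparatesPoints := by
  intro φ ψ hne
  obtain ⟨T, hT, hφ, hψ⟩ := exists_bandProjection_eq_zero_and_eq_one hV hne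
  exact ⟨_, ⟨_, Algebra.subset_adjoin ⟨T, hT, rfl⟩, rfl⟩, by simp [hφ, hψ]⟩

variable [IsOrderedModule ℝ V] [OrderUnitSpace V]

instance : CompactSpace (characters V) :=
  isCompact_iff_compactSpace.1
    (isCompact_states.of_isClosed_subset (isClosed_characters V) fun _ h => h.1)

theorem mem_characters_of_mem_extremePoints {φ : WeakDual ℝ V}
    (hφ : φ ∈ (states V).extremePoints ℝ) : φ ∈ characters V := by
  refine ⟨hφ.1, fun T hT x => ?_⟩
  let ψ : WeakDual ℝ V := (φ : V →L[ℝ] ℝ).comp ⟨T, continuous_of_nonneg hT.nonneg⟩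
  refine apply_eq_mul_of_mem_extremePoints hφ (ψ := ψ) (fun y hy => hφ.1.2 _ (hT.nonneg y hy))
    (fun y hy => ?_) x
  have := hφ.1.2 _ (sub_nonneg.2 (hT.le_self y hy))
  rwa [map_sub, sub_nonneg] at this

theorem exists_character_apply_eq_norm {q : V} (hq : 0 ≤ q) (hq0 : q ≠ 0) :
    ∃ φ : characters V, φ.1 q = ‖q‖ :=
  let ⟨φ, hφ, h⟩ := exists_extremePoint_apply_eq_norm hq hq0
  ⟨⟨φ, mem_characters_of_mem_extremePoints hφ⟩, h⟩

theorem gelfand_nonneg_iff (hV : HasBandComparability V) {x : V} : 0 ≤ gelfand V x ↔ 0 ≤ x := by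
  refine ⟨fun h => ?_, fun h => by simpa using gelfand_mono h⟩
  obtain ⟨T, hT, hpos, hle⟩ := hV x
  -- a character peaking at the negative part `T x - x` would be negative at `x`
  suffices T x - x = 0 by rwa [← sub_eq_zero.1 this]
  by_contra hne
  obtain ⟨φ, hφ⟩ := exists_character_apply_eq_norm (sub_nonneg.2 hle) hne
  have hTφ : gelfand V (T 1) φ * ‖T x - x‖ = 0 := by
    rw [← hφ, gelfand_apply, ← φ.2.2 T hT, map_sub, hT.idempotent, sub_self, map_zero]
  have hT1 : φ.1 (T 1) = 0 := (mul_eq_zero.1 hTφ).resolve_right (norm_ne_zero_iff.2 hne)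
  rw [map_sub, φ.2.2 T hT, hT1] at hφ
  have hx : 0 ≤ φ.1 x := h φ
  linarith [norm_pos_iff.2 hne]

theorem gelfand_le_gelfand_iff (hV : HasBandComparability V) {x y : V} :
    gelfand V x ≤ gelfand V y ↔ x ≤ y := by
  rw [← sub_nonneg, ← map_sub, gelfand_nonneg_iff hV, sub_nonneg]

theorem gelfand_isometry (hV : HasBandComparability V) : Isometry (gelfand V) := by
  refine AddMonoidHomClass.isometry_of_norm _ fun x => le_antisymm ?_ ?_
  · exact (ContinuousMap.norm_le _ (norm_nonneg x)).2 fun φ => abs_state_apply_le φ.2.1 x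
  · refine norm_le_of_bounds (norm_nonneg _) ((gelfand_le_gelfand_iff hV).1 fun φ => ?_)
      ((gelfand_le_gelfand_iff hV).1 fun φ => ?_)
    · simpa [gelfand_one] using neg_le_of_abs_le ((gelfand V x).norm_coe_le_norm φ)
    · simpa [gelfand_one] using le_of_abs_le ((gelfand V x).norm_coe_le_norm φ)

theorem gelfand_surjective [CompleteSpace V] (hV : HasBandComparability V) :
    Function.Surjective (gelfand V) := by
  have hclosed : IsClosed (Set.range (gelfand V)) :=
    (gelfand_isometry hV).isClosedEmbedding.isClosed_range
  have hle : (bandSubalgebra V : Set C(characters V, ℝ)) ⊆ Set.range (gelfand V) := fun f hf => by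
    simpa using mul_mem_range_gelfand hf ⟨1, gelfand_one⟩
  intro f
  have hf : f ∈ (bandSubalgebra V).topologicalClosure :=
    ContinuousMap.subalgebra_topologicalClosure_eq_top_of_separatesPoints _
      (bandSubalgebra_separatesPoints hV) ▸ trivial
  exact hclosed.closure_subset_iff.2 hle hf

end Characters

end OrderUnitSpace

namespace CompressionBase

open OrderUnitSpace

theorem mackeyCompatible_comm {A : Type*} [AddCommGroup A] [PartialOrder A] [One A] {p q : A} :
    MackeyCompatible p q ↔ MackeyCompatible q p := by
  have hsymm : ∀ {p q : A}, MackeyCompatible p q → MackeyCompatible q p :=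
    fun ⟨c, hc, p₁, hp₁, q₁, hq₁, h, hp, hq⟩ =>
      ⟨c, hc, q₁, hq₁, p₁, hp₁, by rwa [add_right_comm], hq, hp⟩
  exact ⟨hsymm, hsymm⟩

section Compressions

variable {A : Type*} [AddCommGroup A] [Module ℝ A] [PartialOrder A] [One A]
  {b : CompressionBase A} {p q r x y : A}

theorem effect_of_mem (hp : p ∈ b.proj) : p ∈ effects A :=
  b.normalSubalgebra.subset_effects hp

theorem compl_mem (hp : p ∈ b.proj) : 1 - p ∈ b.proj :=
  b.normalSubalgebra.compl_mem p hp

theorem J_nonneg (hp : p ∈ b.proj) (h : 0 ≤ x) : 0 ≤ b.J p x :=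
  (b.isCompression p hp).positive x h

theorem J_one (hp : p ∈ b.proj) : b.J p 1 = p :=
  (b.isCompression p hp).map_one

theorem J_of_le (hp : p ∈ b.proj) (hx : 0 ≤ x) (h : x ≤ p) : b.J p x = x :=
  (b.isCompression p hp).map_of_le x ⟨hx, h.trans (effect_of_mem hp).2⟩ h

theorem J_self (hp : p ∈ b.proj) : b.J p p = p :=
  J_of_le hp (effect_of_mem hp).1 le_rfl

theorem le_of_J_compl_eq_zero (hp : p ∈ b.proj) (hx : x ∈ effects A) (h : b.J (1 - p) x = 0) :
    x ≤ p := by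
  simpa using (b.isCompression _ (compl_mem hp)).le_of_map_eq_zero x hx h

theorem J_idempotent (hp : p ∈ b.proj) (x : A) : b.J p (b.J p x) = b.J p x := by
  have h0 := b.normalSubalgebra.zero_mem
  simpa using LinearMap.congr_fun
    (b.comp_eq 0 h0 0 h0 p hp (by simpa using (effect_of_mem hp).2)) x

/-- `C(p)` as a linear subspace. -/
def projCommutantSubmodule (b : CompressionBase A) (p : A) : Submodule ℝ A :=
  LinearMap.eqLocus LinearMap.id (b.J p + b.J (1 - p))

theorem projCommutant_compl (b : CompressionBase A) (p : A) :
    b.projCommutant (1 - p) = b.projCommutant p := by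
  ext x
  simp [projCommutant, add_comm]

theorem one_mem_projCommutant (hp : p ∈ b.proj) : 1 ∈ b.projCommutant p := by
  simp [projCommutant, J_one hp, J_one (compl_mem hp)]

theorem mem_PC_singleton : p ∈ b.PC {x} ↔ p ∈ b.proj ∧ x ∈ b.projCommutant p := by
  simp [PC]

theorem mem_projBicommutant_iff : p ∈ b.projBicommutant x ↔
    p ∈ b.proj ∧ x ∈ b.projCommutant p ∧ ∀ r ∈ b.PC {x}, r ∈ b.projCommutant p :=
  ⟨fun h => ⟨h.1, h.2 x (.inr rfl), fun r hr => h.2 r (.inl hr)⟩,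
    fun h => ⟨h.1, fun r hr => hr.elim (h.2.2 r) fun hrx => hrx ▸ h.2.1⟩⟩

theorem compl_mem_projBicommutant (hp : p ∈ b.projBicommutant x) :
    1 - p ∈ b.projBicommutant x := by
  rw [mem_projBicommutant_iff, projCommutant_compl] at *
  exact ⟨compl_mem hp.1, hp.2⟩

theorem commutes_comm : b.Commutes x y ↔ b.Commutes y x :=
  ⟨fun h p hp q hq => mackeyCompatible_comm.1 (h q hq p hp),
    fun h p hp q hq => mackeyCompatible_comm.1 (h q hq p hp)⟩

variable [IsOrderedAddMonoid A]

theorem J_mono (hp : p ∈ b.proj) (h : x ≤ y) : b.J p x ≤ b.J p y := by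
  simpa using J_nonneg hp (sub_nonneg.2 h)

theorem J_le (hp : p ∈ b.proj) (h : x ≤ 1) : b.J p x ≤ p :=
  (J_mono hp h).trans_eq (J_one hp)

theorem J_of_le_compl (hp : p ∈ b.proj) (hx : 0 ≤ x) (h : x ≤ 1 - p) : b.J p x = 0 := by
  refine le_antisymm ((J_mono hp h).trans_eq ?_) (J_nonneg hp hx)
  rw [map_sub, J_one hp, J_self hp, sub_self]

theorem J_compl_of_le (hp : p ∈ b.proj) (hx : 0 ≤ x) (h : x ≤ p) : b.J (1 - p) x = 0 :=
  J_of_le_compl (compl_mem hp) hx (by simpa using h)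

theorem eq_zero_of_le_of_le_compl (hp : p ∈ b.proj) (hx : 0 ≤ x) (h : x ≤ p) (h' : x ≤ 1 - p) :
    x = 0 := by
  rw [← J_of_le hp hx h, J_of_le_compl hp hx h']

theorem J_le_self (hp : p ∈ b.proj) (hxp : x ∈ b.projCommutant p) (hx : 0 ≤ x) : b.J p x ≤ x := by
  conv_rhs => rw [hxp]
  exact le_add_of_nonneg_right (J_nonneg (compl_mem hp) hx)

theorem sub_mem (hp : p ∈ b.proj) (hq : q ∈ b.proj) (h : p ≤ q) : q - p ∈ b.proj := by
  have hle : p + (1 - q) ≤ 1 := by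
    rw [add_sub_left_comm]
    exact add_le_of_nonpos_right (sub_nonpos.2 h)
  convert compl_mem (b.normalSubalgebra.add_mem p hp (1 - q) (compl_mem hq) hle) using 1
  abel

theorem add_le_of_le (hp : p ∈ b.proj) (hx : 0 ≤ x) (hy : 0 ≤ y) (hxp : x ≤ p) (hyp : y ≤ p)
    (hxy : x + y ≤ 1) : x + y ≤ p := by
  rw [← J_of_le hp hx hxp, ← J_of_le hp hy hyp, ← map_add]
  exact J_le hp hxy

theorem add_mem_projCommutant (hp : p ∈ b.proj) (hx : 0 ≤ x) (hxp : x ≤ p) (hy : 0 ≤ y)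
    (hyp : y ≤ 1 - p) : x + y ∈ b.projCommutant p := by
  change x + y = b.J p (x + y) + b.J (1 - p) (x + y)
  rw [map_add, map_add, J_of_le hp hx hxp, J_of_le_compl hp hy hyp, J_compl_of_le hp hx hxp,
    J_of_le (compl_mem hp) hy hyp, add_zero, zero_add]

theorem mackeyCompatible_iff (hp : p ∈ b.proj) (hq : q ∈ effects A) :
    MackeyCompatible p q ↔ q ∈ b.projCommutant p := by
  have hp' := compl_mem hp
  refine ⟨?_, fun h => ?_⟩
  · rintro ⟨c, hc, p₁, hp₁, q₁, hq₁, hE, rfl, rfl⟩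
    exact add_mem_projCommutant hp hc.1 (le_add_of_nonneg_right hp₁.1) hq₁.1
      (le_sub_iff_add_le'.2 hE.2)
  · have hle : b.J p q ≤ p := J_le hp hq.2
    have h₀ : 0 ≤ b.J p q := J_nonneg hp hq.1
    have h₀' : 0 ≤ b.J (1 - p) q := J_nonneg hp' hq.1
    have hle' : b.J (1 - p) q ≤ 1 - p := J_le hp' hq.2
    refine ⟨_, ⟨h₀, hle.trans (effect_of_mem hp).2⟩, p - b.J p q, ⟨sub_nonneg.2 hle, ?_⟩,
      _, ⟨h₀', hle'.trans (effect_of_mem hp').2⟩, ⟨?_, ?_⟩, (add_sub_cancel _ _).symm, h⟩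
    · exact (sub_le_self _ h₀).trans (effect_of_mem hp).2
    · rw [add_sub_cancel]
      exact add_nonneg (effect_of_mem hp).1 h₀'
    · rw [add_sub_cancel]
      exact le_sub_iff_add_le'.1 hle'

theorem mem_projCommutant_comm (hp : p ∈ b.proj) (hq : q ∈ b.proj) :
    q ∈ b.projCommutant p ↔ p ∈ b.projCommutant q := by
  rw [← mackeyCompatible_iff hp (effect_of_mem hq), ← mackeyCompatible_iff hq (effect_of_mem hp)]
  exact mackeyCompatible_comm

theorem J_comm (hp : p ∈ b.proj) (hq : q ∈ b.proj) (h : q ∈ b.projCommutant p) (x : A) :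
    b.J p (b.J q x) = b.J q (b.J p x) := by
  obtain ⟨c, hc, p₁, hp₁, q₁, hq₁, hE, rfl, rfl⟩ := (mackeyCompatible_iff hp (effect_of_mem hq)).2 h
  have hcP : c ∈ b.proj := b.normalSubalgebra.normal c hc p₁ hp₁ q₁ hq₁ hE.2 hp hq
  have hp₁P : p₁ ∈ b.proj := by
    simpa using sub_mem hcP hp (le_add_of_nonneg_right hp₁.1)
  have hq₁P : q₁ ∈ b.proj := by
    simpa using sub_mem hcP hq (le_add_of_nonneg_right hq₁.1)
  -- both composites are `J c`
  have hpq := b.comp_eq p₁ hp₁P q₁ hq₁P c hcP (add_rotate c p₁ q₁ ▸ hE.2)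
  have hqp := b.comp_eq q₁ hq₁P p₁ hp₁P c hcP (by
    rw [← add_rotate, add_right_comm]
    exact hE.2)
  rw [add_comm c, add_comm c, ← LinearMap.comp_apply, hpq, ← LinearMap.comp_apply, hqp]

theorem J_mem_projCommutant (hp : p ∈ b.proj) (hr : r ∈ b.proj) (h : p ∈ b.projCommutant r)
    (hx : x ∈ b.projCommutant r) : b.J p x ∈ b.projCommutant r := by
  have h' : p ∈ b.projCommutant (1 - r) := by rwa [projCommutant_compl]
  change b.J p x = b.J r (b.J p x) + b.J (1 - r) (b.J p x)
  rw [J_comm hr hp h, J_comm (compl_mem hr) hp h', ← map_add, ← hx]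

theorem self_mem_projCommutant (hp : p ∈ b.proj) : p ∈ b.projCommutant p := by
  simpa using add_mem_projCommutant hp (effect_of_mem hp).1 le_rfl le_rfl
    (effect_of_mem (compl_mem hp)).1

theorem self_mem_projBicommutant (hp : p ∈ b.proj) : p ∈ b.projBicommutant p :=
  mem_projBicommutant_iff.2 ⟨hp, self_mem_projCommutant hp, fun _ hr =>
    (mem_projCommutant_comm hp (mem_PC_singleton.1 hr).1).2 (mem_PC_singleton.1 hr).2⟩

theorem projBicommutant_subset_projCommutant (hr : r ∈ b.PC {x}) :
    b.projBicommutant x ⊆ b.projCommutant r := fun _ hq =>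
  have hq := mem_projBicommutant_iff.1 hq
  (mem_projCommutant_comm hq.1 hr.1).1 (hq.2.2 r hr)

theorem cover_mem_projCommutant (hb : b.HasProjectionCover) (hr : r ∈ b.proj) (hx : x ∈ effects A)
    (hxr : x ∈ b.projCommutant r) (hp : p ∈ b.proj) (hcov : ∀ q ∈ b.proj, x ≤ q ↔ p ≤ q) :
    p ∈ b.projCommutant r := by
  have hr' := compl_mem hr
  have h₀ := J_nonneg hr hx.1
  have h₀' := J_nonneg hr' hx.1
  have hle := J_le hr hx.2
  have hle' := J_le hr' hx.2
  obtain ⟨c, hc, hcov₁⟩ := hb _ ⟨h₀, hle.trans (effect_of_mem hr).2⟩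
  obtain ⟨d, hd, hcov₂⟩ := hb _ ⟨h₀', hle'.trans (effect_of_mem hr').2⟩
  have hcr : c ≤ r := (hcov₁ r hr).1 hle
  have hdr : d ≤ 1 - r := (hcov₂ _ hr').1 hle'
  have hcd : c + d ≤ 1 := (add_le_add hcr hdr).trans_eq (add_sub_cancel _ _)
  have hxp : x ≤ p := (hcov p hp).2 le_rfl
  have hpcd : p = c + d := by
    refine le_antisymm ((hcov _ (b.normalSubalgebra.add_mem c hc d hd hcd)).1 ?_)
      (add_le_of_le hp (effect_of_mem hc).1 (effect_of_mem hd).1 ((hcov₁ p hp).1 ?_)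
        ((hcov₂ p hp).1 ?_) hcd)
    · rw [hxr]
      exact add_le_add ((hcov₁ c hc).2 le_rfl) ((hcov₂ d hd).2 le_rfl)
    · exact (J_le_self hr hxr hx.1).trans hxp
    · exact (J_le_self hr' (by rwa [projCommutant_compl]) hx.1).trans hxp
  rw [hpcd]
  exact add_mem_projCommutant hr (effect_of_mem hc).1 hcr (effect_of_mem hd).1 hdr

theorem eq_zero_of_le_of_forall_le_compl (hb : b.HasProjectionCover) {ι : Type*} {p : ι → A}
    (hp : ∀ i, p i ∈ b.proj) (hq : q ∈ b.proj) (hlub : ∀ r ∈ b.proj, q ≤ r ↔ ∀ i, p i ≤ r)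
    (hx : 0 ≤ x) (hxq : x ≤ q) (hxp : ∀ i, x ≤ 1 - p i) : x = 0 := by
  obtain ⟨c, hc, hcov⟩ := hb x ⟨hx, hxq.trans (effect_of_mem hq).2⟩
  have hqc : q ≤ 1 - c := (hlub _ (compl_mem hc)).2 fun i =>
    le_sub_comm.1 ((hcov _ (compl_mem (hp i))).1 (hxp i))
  exact eq_zero_of_le_of_le_compl hq hx hxq
    (((hcov c hc).2 le_rfl).trans (le_sub_comm.1 hqc))

end Compressions

section Bicommutant

variable {A : Type*} [NormedAddCommGroup A] [NormedSpace ℝ A] [PartialOrder A]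
  [IsOrderedAddMonoid A] [IsOrderedModule ℝ A] [One A] [OrderUnitSpace A]
  {b : CompressionBase A} {a p r x : A}

theorem isClosed_projCommutant (hp : p ∈ b.proj) : IsClosed (b.projCommutant p) :=
  isClosed_eq continuous_id <|
    (continuous_of_nonneg (b.isCompression p hp).positive).add
      (continuous_of_nonneg (b.isCompression _ (compl_mem hp)).positive)

theorem exists_mem_projBicommutant_bounds (hb : b.HasComparability) (x : A) :
    ∃ p ∈ b.projBicommutant x, -(‖x‖ • (1 - p)) ≤ x ∧ x ≤ ‖x‖ • p := by
  obtain ⟨p, hp, hneg, hpos⟩ := hb x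
  obtain ⟨hpP, hxp, -⟩ := mem_projBicommutant_iff.1 hp
  have h₁ := J_mono (compl_mem hpP) (neg_norm_smul_one_le x)
  have h₂ := J_mono hpP (le_norm_smul_one x)
  rw [map_neg, map_smul, J_one (compl_mem hpP)] at h₁
  rw [map_smul, J_one hpP] at h₂
  refine ⟨p, hp, h₁.trans ?_, le_trans ?_ h₂⟩
  · conv_rhs => rw [hxp]
    exact le_add_of_nonneg_left hpos
  · conv_lhs => rw [hxp]
    exact add_le_of_nonpos_right hneg

theorem exists_span_projBicommutant_norm_sub_le (hb : b.HasComparability) (x : A) :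
    ∃ s ∈ Submodule.span ℝ (b.projBicommutant x), ‖x - s‖ ≤ ‖x‖ / 2 ∧
      b.projBicommutant (x - s) ⊆ b.projBicommutant x := by
  obtain ⟨p, hp, h₁, h₂⟩ := exists_mem_projBicommutant_bounds hb x
  obtain ⟨hpP, hxp, -⟩ := mem_projBicommutant_iff.1 hp
  let s := (‖x‖ / 2) • p - (‖x‖ / 2) • (1 - p)
  have hs : ∀ r ∈ b.proj, p ∈ b.projCommutant r → s ∈ b.projCommutantSubmodule r := fun r hr hpr =>
    Submodule.sub_mem _ (Submodule.smul_mem _ _ hpr)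
      (Submodule.smul_mem _ _ (Submodule.sub_mem _ (one_mem_projCommutant hr) hpr))
  have hPC : ∀ r ∈ b.proj, p ∈ b.projCommutant r → (r ∈ b.PC {x - s} ↔ r ∈ b.PC {x}) := by
    intro r hr hpr
    simp only [mem_PC_singleton]
    exact and_congr_right fun _ =>
      (b.projCommutantSubmodule r).sub_mem_iff_left (hs r hr hpr)
  refine ⟨s, Submodule.sub_mem _ (Submodule.smul_mem _ _ (Submodule.subset_span hp))
    (Submodule.smul_mem _ _ (Submodule.subset_span (compl_mem_projBicommutant hp))),
    norm_le_of_bounds (by positivity) ?_ ?_, fun q hq => ?_⟩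
  · rw [le_sub_iff_add_le]
    convert h₁ using 1
    module
  · rw [sub_le_iff_le_add]
    convert h₂ using 1
    module
  · obtain ⟨hqP, hxq, hq⟩ := mem_projBicommutant_iff.1 hq
    have hpq : p ∈ b.projCommutant q :=
      hq p ((hPC p hpP (self_mem_projCommutant hpP)).2 (mem_PC_singleton.2 ⟨hpP, hxp⟩))
    refine mem_projBicommutant_iff.2 ⟨hqP, ?_, fun r hr => hq r ?_⟩
    · exact ((b.projCommutantSubmodule q).sub_mem_iff_left (hs q hqP hpq)).1 hxq
    · exact (hPC r hr.1 (projBicommutant_subset_projCommutant hr hp)).2 hr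

theorem mem_closure_span_projBicommutant (hb : b.HasComparability) (x : A) :
    x ∈ closure (Submodule.span ℝ (b.projBicommutant x) : Set A) := by
  have happrox : ∀ (n : ℕ) (x : A),
      ∃ s ∈ Submodule.span ℝ (b.projBicommutant x), ‖x - s‖ ≤ ‖x‖ / 2 ^ n := by
    intro n
    induction n with
    | zero => exact fun x => ⟨0, Submodule.zero_mem _, by simp⟩
    | succ n ih =>
      intro x
      obtain ⟨s, hs, hxs, hsub⟩ := exists_span_projBicommutant_norm_sub_le hb x
      obtain ⟨t, ht, hxt⟩ := ih (x - s)
      refine ⟨s + t, Submodule.add_mem _ hs (Submodule.span_mono hsub ht), ?_⟩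
      rw [← sub_sub, pow_succ', ← div_div]
      exact hxt.trans (by gcongr)
  choose s hs hxs using fun n => happrox n x
  refine mem_closure_of_tendsto (f := s) (b := Filter.atTop) ?_ (.of_forall hs)
  have hlim : Tendsto (fun n : ℕ => ‖x‖ / 2 ^ n) atTop (𝓝 0) := by
    simpa [div_eq_mul_inv] using
      (tendsto_pow_atTop_nhds_zero_of_lt_one (r := (2 : ℝ)⁻¹) (by norm_num)
        (by norm_num)).const_mul ‖x‖
  rw [tendsto_iff_norm_sub_tendsto_zero]
  exact squeeze_zero (fun _ => norm_nonneg _) (fun n => norm_sub_rev x (s n) ▸ hxs n) hlim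

theorem mem_projCommutant_iff (hb : b.HasComparability) (hr : r ∈ b.proj) :
    x ∈ b.projCommutant r ↔ ∀ q ∈ b.projBicommutant x, q ∈ b.projCommutant r := by
  refine ⟨fun h q hq => projBicommutant_subset_projCommutant (mem_PC_singleton.2 ⟨hr, h⟩) hq,
    fun h => ?_⟩
  exact (isClosed_projCommutant hr).closure_subset_iff.2
    (Submodule.span_le (p := b.projCommutantSubmodule r).2 h)
    (mem_closure_span_projBicommutant hb x)

theorem commutes_iff (hb : b.HasComparability) :
    b.Commutes a x ↔ ∀ p ∈ b.projBicommutant a, x ∈ b.projCommutant p :=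
  forall₂_congr fun _ hp => (forall₂_congr fun _ hq => mackeyCompatible_iff hp.1
    (effect_of_mem hq.1)).trans (mem_projCommutant_iff hb hp.1).symm

theorem mem_bicommutant_iff (hb : b.HasComparability) :
    x ∈ b.bicommutant a ↔ ∀ r ∈ b.PC {a}, x ∈ b.projCommutant r := by
  refine ⟨fun hx r hr => ?_, fun hx y hy => ?_⟩
  · have har : b.Commutes a r :=
      (commutes_iff hb).2 fun p hp => (mem_projBicommutant_iff.1 hp).2.2 r hr
    exact (commutes_iff hb).1 (hx r fun _ h => h ▸ har) r (self_mem_projBicommutant hr.1)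
  · refine (commutes_iff hb).2 fun q hq => hx q (mem_PC_singleton.2 ⟨hq.1, ?_⟩)
    exact (commutes_iff hb).1 (commutes_comm.1 (hy a rfl)) q hq

theorem mem_projBicommutant_iff_mem_bicommutant (hb : b.HasComparability) :
    p ∈ b.projBicommutant a ↔ p ∈ b.proj ∧ p ∈ b.bicommutant a := by
  rw [mem_bicommutant_iff hb]
  refine ⟨fun hp => ⟨hp.1, fun r hr => projBicommutant_subset_projCommutant hr hp⟩,
    fun ⟨hp, hpa⟩ => ?_⟩
  have hcomm : ∀ r ∈ b.PC {a}, r ∈ b.projCommutant p := fun r hr =>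
    (mem_projCommutant_comm hp hr.1).2 (hpa r hr)
  refine mem_projBicommutant_iff.2 ⟨hp, (mem_projCommutant_iff hb hp).2 fun q hq => ?_, hcomm⟩
  exact hcomm q (mem_PC_singleton.2 ⟨hq.1, (mem_projBicommutant_iff.1 hq).2.1⟩)

theorem self_mem_bicommutant (hb : b.HasComparability) (a : A) : a ∈ b.bicommutant a :=
  (mem_bicommutant_iff hb).2 fun _ hr => (mem_PC_singleton.1 hr).2

theorem mem_projCommutant_of_mem_bicommutant (hb : b.HasComparability)
    (hx : x ∈ b.bicommutant a) (hp : p ∈ b.projBicommutant a) : x ∈ b.projCommutant p :=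
  (mem_bicommutant_iff hb).1 hx p
    (mem_PC_singleton.2 ⟨hp.1, (mem_projBicommutant_iff.1 hp).2.1⟩)

theorem projBicommutant_subset_of_mem_bicommutant (hb : b.HasComparability)
    (hx : x ∈ b.bicommutant a) : b.projBicommutant x ⊆ b.projBicommutant a := fun _ hq =>
  (mem_projBicommutant_iff_mem_bicommutant hb).2 ⟨hq.1, (mem_bicommutant_iff hb).2 fun r hr =>
    projBicommutant_subset_projCommutant
      (mem_PC_singleton.2 ⟨hr.1, (mem_bicommutant_iff hb).1 hx r hr⟩) hq⟩

theorem J_mem_bicommutant (hb : b.HasComparability) (hp : p ∈ b.projBicommutant a)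
    (hx : x ∈ b.bicommutant a) : b.J p x ∈ b.bicommutant a :=
  (mem_bicommutant_iff hb).2 fun r hr => J_mem_projCommutant hp.1 hr.1
    (projBicommutant_subset_projCommutant hr hp) ((mem_bicommutant_iff hb).1 hx r hr)

/-- `CC(a)` as a linear subspace, for spectral compression bases. -/
def bicommutantSubmodule (b : CompressionBase A) (a : A) : Submodule ℝ A :=
  ⨅ r ∈ b.PC {a}, b.projCommutantSubmodule r

theorem mem_bicommutantSubmodule (hb : b.HasComparability) :
    x ∈ b.bicommutantSubmodule a ↔ x ∈ b.bicommutant a := by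
  rw [bicommutantSubmodule, mem_bicommutant_iff hb]
  simp only [Submodule.mem_iInf]
  rfl

theorem isClosed_bicommutantSubmodule (b : CompressionBase A) (a : A) :
    IsClosed (b.bicommutantSubmodule a : Set A) := by
  simp only [bicommutantSubmodule, Submodule.coe_iInf]
  exact isClosed_biInter fun r hr => isClosed_projCommutant hr.1

theorem zero_mem_projBicommutant (hb : b.HasComparability) (a : A) : 0 ∈ b.projBicommutant a :=
  (mem_projBicommutant_iff_mem_bicommutant hb).2
    ⟨b.normalSubalgebra.zero_mem, (mem_bicommutantSubmodule hb).1 (Submodule.zero_mem _)⟩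

instance (b : CompressionBase A) (a : A) : One (b.bicommutantSubmodule a) :=
  ⟨⟨1, by
    simp only [bicommutantSubmodule, Submodule.mem_iInf]
    exact fun r hr => one_mem_projCommutant hr.1⟩⟩

instance (b : CompressionBase A) (a : A) : IsOrderedModule ℝ (b.bicommutantSubmodule a) :=
  .of_smul_nonneg fun r hr x hx => show (0 : A) ≤ r • (x : A) from smul_nonneg hr hx

instance (b : CompressionBase A) (a : A) : OrderUnitSpace (b.bicommutantSubmodule a) where
  zero_le_one' := zero_le_one' (A := A)
  exists_le_smul_one x := exists_le_smul_one x.1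
  archimedean x y := archimedean x.1 y.1
  norm_eq x := norm_eq x.1

theorem hasBandComparability_bicommutantSubmodule (hb : b.HasComparability) (a : A) :
    HasBandComparability (b.bicommutantSubmodule a) := by
  intro x
  have hx := (mem_bicommutantSubmodule hb).1 x.2
  obtain ⟨p, hpx, hneg, hpos⟩ := hb (x : A)
  have hp := projBicommutant_subset_of_mem_bicommutant hb hx hpx
  let T : b.bicommutantSubmodule a →ₗ[ℝ] b.bicommutantSubmodule a :=
    (b.J p).restrict fun y hy => (mem_bicommutantSubmodule hb).2
      (J_mem_bicommutant hb hp ((mem_bicommutantSubmodule hb).1 hy))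
  have hT : IsBandProjection T :=
    { nonneg := fun y hy => J_nonneg hp.1 hy
      le_self := fun y hy => J_le_self hp.1
        (mem_projCommutant_of_mem_bicommutant hb ((mem_bicommutantSubmodule hb).1 y.2) hp) hy
      idempotent := fun y => Subtype.ext (J_idempotent hp.1 y) }
  refine ⟨T, hT, hpos, ?_⟩
  change (x : A) ≤ b.J p x
  conv_lhs => rw [(mem_projBicommutant_iff.1 hpx).2.1]
  exact add_le_of_nonpos_right hneg

theorem exists_isFunctionRep {A : Type u} [NormedAddCommGroup A] [NormedSpace ℝ A]
    [PartialOrder A] [IsOrderedAddMonoid A] [IsOrderedModule ℝ A] [One A] [OrderUnitSpace A]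
    [CompleteSpace A] {b : CompressionBase A} (hb : b.HasComparability) (a : A) :
    ∃ (X : Type u) (_ : TopologicalSpace X) (_ : CompactSpace X) (_ : T2Space X)
      (_ : TotallyDisconnectedSpace X) (ι : C(X, ℝ) →ₗ[ℝ] A), b.IsFunctionRep a ι := by
  have hV := hasBandComparability_bicommutantSubmodule hb a
  have := (isClosed_bicommutantSubmodule b a).completeSpace_coe
  have hinj : Function.Injective (gelfand (b.bicommutantSubmodule a)) := fun x y h =>
    le_antisymm ((gelfand_le_gelfand_iff hV).1 h.le) ((gelfand_le_gelfand_iff hV).1 h.ge)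
  let Φ := LinearEquiv.ofBijective (gelfand (b.bicommutantSubmodule a))
    ⟨hinj, gelfand_surjective hV⟩
  refine ⟨characters (b.bicommutantSubmodule a), inferInstance, inferInstance, inferInstance,
    totallyDisconnectedSpace_characters hV,
    (b.bicommutantSubmodule a).subtype ∘ₗ Φ.symm.toLinearMap, ?_, fun f g => ?_, ?_⟩
  · have h : Φ.symm 1 = 1 := Φ.symm_apply_eq.2 gelfand_one.symm
    exact congrArg Subtype.val h
  · change Φ.symm f ≤ Φ.symm g ↔ f ≤ g
    rw [← gelfand_le_gelfand_iff hV]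
    change Φ (Φ.symm f) ≤ Φ (Φ.symm g) ↔ f ≤ g
    rw [Φ.apply_symm_apply, Φ.apply_symm_apply]
  · ext x
    rw [← mem_bicommutantSubmodule hb]
    exact ⟨fun ⟨f, hf⟩ => hf ▸ (Φ.symm f).2, fun hx => ⟨Φ ⟨x, hx⟩, by simp⟩⟩

theorem exists_effect_le_iff_forall_le [CompleteSpace A] {p : ℕ → A} (hp : ∀ n, p n ∈ b.proj) :
    ∃ e ∈ effects A, (∀ r ∈ b.proj, (∀ n, p n ∈ b.projCommutant r) → e ∈ b.projCommutant r) ∧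
      ∀ q ∈ b.proj, e ≤ q ↔ ∀ n, p n ≤ q := by
  let w : ℕ → ℝ := fun n => 1 / 2 / 2 ^ n
  have hw : ∀ n, 0 < w n := fun n => by positivity
  have hsum : HasSum w 1 := hasSum_geometric_two' 1
  have hwp : ∀ n, 0 ≤ w n • p n := fun n => smul_nonneg (hw n).le (effect_of_mem (hp n)).1
  have hnorm : ∀ n, ‖w n • p n‖ ≤ w n := fun n =>
    norm_le_of_bounds (hw n).le
      ((neg_nonpos.2 (smul_nonneg (hw n).le OrderUnitSpace.zero_le_one')).trans (hwp n))
      (smul_le_smul_of_nonneg_left (effect_of_mem (hp n)).2 (hw n).le)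
  obtain ⟨e, he⟩ := Summable.of_norm_bounded hsum.summable hnorm
  have hle_of : ∀ q, (∀ n, p n ≤ q) → e ≤ q := fun q hq => by
    simpa using hasSum_le (fun n => smul_le_smul_of_nonneg_left (hq n) (hw n).le) he
      (hsum.smul_const q)
  have hle : ∀ n, w n • p n ≤ e := fun n => le_hasSum he n fun m _ => hwp m
  have heff : e ∈ effects A :=
    ⟨(hwp 0).trans (hle 0), hle_of 1 fun n => (effect_of_mem (hp n)).2⟩
  refine ⟨e, heff, fun r hr hpr => ?_, fun q hq => ⟨fun heq n => ?_, hle_of q⟩⟩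
  · exact (isClosed_projCommutant hr).mem_of_tendsto he <| .of_forall fun s =>
      (b.projCommutantSubmodule r).sum_mem fun n _ => Submodule.smul_mem _ _ (hpr n)
  · have hJ : b.J (1 - q) (w n • p n) ≤ 0 :=
      (J_mono (compl_mem hq) (hle n)).trans_eq (J_compl_of_le hq heff.1 heq)
    have hJ₀ := hJ.antisymm (J_nonneg (compl_mem hq) (hwp n))
    rw [map_smul, smul_eq_zero_iff_right (hw n).ne'] at hJ₀
    exact le_of_J_compl_eq_zero hq (effect_of_mem (hp n)) hJ₀

theorem exists_mem_projBicommutant_le_iff_forall_le [CompleteSpace A] (hb : b.IsSpectral)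
    {p : ℕ → A} (hp : ∀ n, p n ∈ b.projBicommutant a) :
    ∃ s ∈ b.projBicommutant a, ∀ q ∈ b.proj, s ≤ q ↔ ∀ n, p n ≤ q := by
  obtain ⟨e, he, hecomm, hep⟩ := exists_effect_le_iff_forall_le fun n => (hp n).1
  obtain ⟨s, hs, hes⟩ := hb.1 e he
  refine ⟨s, (mem_projBicommutant_iff_mem_bicommutant hb.2).2 ⟨hs, ?_⟩, fun q hq =>
    (hes q hq).symm.trans (hep q hq)⟩
  refine (mem_bicommutant_iff hb.2).2 fun r hr =>
    cover_mem_projCommutant hb.1 hr.1 he (hecomm r hr.1 fun n => ?_) hs hes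
  exact projBicommutant_subset_projCommutant hr (hp n)

end Bicommutant

namespace IsFunctionRep

section Order

variable {A : Type*} [AddCommGroup A] [Module ℝ A] [PartialOrder A] [One A]
  {b : CompressionBase A} {a : A} {X : Type*} [TopologicalSpace X] {ι : C(X, ℝ) →ₗ[ℝ] A}

theorem apply_mem (hι : b.IsFunctionRep a ι) (f : C(X, ℝ)) : ι f ∈ b.bicommutant a :=
  hι.range_eq ▸ Set.mem_range_self f

theorem exists_apply_eq (hι : b.IsFunctionRep a ι) {x : A} (hx : x ∈ b.bicommutant a) :
    ∃ f, ι f = x := by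
  rwa [← hι.range_eq] at hx

theorem nonneg_iff (hι : b.IsFunctionRep a ι) {f : C(X, ℝ)} : 0 ≤ ι f ↔ 0 ≤ f := by
  simpa using hι.le_iff_le 0 f

theorem mem_effects_iff (hι : b.IsFunctionRep a ι) {f : C(X, ℝ)} :
    ι f ∈ effects A ↔ 0 ≤ f ∧ f ≤ 1 := by
  rw [← hι.le_iff_le f 1, hι.map_one, ← hι.nonneg_iff]
  rfl

/-- The order isomorphism `C(X, ℝ) ≃o CC(a)` given by a function representation. -/
noncomputable def orderIso (hι : b.IsFunctionRep a ι) : C(X, ℝ) ≃o b.bicommutant a :=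
  RelIso.ofSurjective
    (OrderEmbedding.ofMapLEIff (fun f => (⟨ι f, hι.apply_mem f⟩ : b.bicommutant a)) hι.le_iff_le)
    fun x => (hι.exists_apply_eq x.2).imp fun _ => Subtype.ext

theorem mem_range_iff [CompactSpace X] (hι : b.IsFunctionRep a ι) {f : C(X, ℝ)} (hf : ι f = a)
    (t : ℝ) : t ∈ Set.range f ↔ ∀ ε > (0 : ℝ), ∃ y ∈ b.bicommutant a,
      a - t • 1 ≤ y ∧ t • 1 - a ≤ y ∧ ¬ ε • 1 ≤ y := by
  rw [mem_range_continuousMap_iff, ← hι.range_eq]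
  simp only [Set.exists_range_iff, ← hι.le_iff_le, map_sub, map_smul, hι.map_one, hf]

theorem spectrum_eq_range {A : Type u} [AddCommGroup A] [Module ℝ A] [PartialOrder A] [One A]
    {b : CompressionBase A} {a : A} {X : Type u} [TopologicalSpace X] [CompactSpace X] [T2Space X]
    [TotallyDisconnectedSpace X] {ι : C(X, ℝ) →ₗ[ℝ] A} (hι : b.IsFunctionRep a ι) {f : C(X, ℝ)}
    (hf : ι f = a) : b.spectrum a = Set.range f := by
  ext t
  refine ⟨?_, fun ht => ⟨X, _, ‹_›, ‹_›, ‹_›, ι, f, hι, hf, ht⟩⟩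
  rintro ⟨Y, _, _, _, _, κ, g, hκ, hg, ht⟩
  exact (hι.mem_range_iff hf t).2 ((hκ.mem_range_iff hg t).1 ht)

variable [IsOrderedAddMonoid A]

theorem eq_zero_or_eq_one_of_mem_proj (hι : b.IsFunctionRep a ι) {g : C(X, ℝ)}
    (hg : ι g ∈ b.proj) (x : X) : g x = 0 ∨ g x = 1 := by
  obtain ⟨hg₀, hg₁⟩ := hι.mem_effects_iff.1 (effect_of_mem hg)
  have hinf : ι (g ⊓ (1 - g)) = 0 := by
    refine eq_zero_of_le_of_le_compl hg (hι.nonneg_iff.2 (le_inf hg₀ (sub_nonneg.2 hg₁)))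
      ((hι.le_iff_le _ _).2 inf_le_left) ?_
    rw [← hι.map_one, ← map_sub, hι.le_iff_le]
    exact inf_le_right
  have hle : g ⊓ (1 - g) ≤ 0 := (hι.le_iff_le _ _).1 (by rw [hinf, map_zero])
  have hx : min (g x) (1 - g x) ≤ 0 := hle x
  have hx₀ : 0 ≤ g x := hg₀ x
  have hx₁ : g x ≤ 1 := hg₁ x
  exact (min_le_iff.1 hx).imp (fun h => h.antisymm hx₀) fun h => by linarith

end Order

section Spectral

variable {A : Type*} [NormedAddCommGroup A] [NormedSpace ℝ A] [PartialOrder A]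
  [IsOrderedAddMonoid A] [IsOrderedModule ℝ A] [One A] [OrderUnitSpace A]
  {b : CompressionBase A} {a : A} {X : Type*} [TopologicalSpace X] {ι : C(X, ℝ) →ₗ[ℝ] A}

theorem exists_spectralProjection (hι : b.IsFunctionRep a ι) (hb : b.HasComparability)
    (f : C(X, ℝ)) (t : ℝ) : ∃ g, ι g ∈ b.projBicommutant a ∧
      ∀ x, g x = 0 ∧ f x ≤ t ∨ g x = 1 ∧ t ≤ f x := by
  obtain ⟨p, hp, h₁, h₂⟩ := exists_mem_projBicommutant_bounds hb (ι (f - t • 1))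
  have hpa := projBicommutant_subset_of_mem_bicommutant hb (hι.apply_mem _) hp
  obtain ⟨g, rfl⟩ := hι.exists_apply_eq ((mem_projBicommutant_iff_mem_bicommutant hb).1 hpa).2
  set M := ‖ι (f - t • 1)‖
  rw [← hι.map_one, ← map_sub, ← map_smul, ← map_neg, hι.le_iff_le] at h₁
  rw [← map_smul, hι.le_iff_le] at h₂
  refine ⟨g, hpa, fun x => (hι.eq_zero_or_eq_one_of_mem_proj hp.1 x).imp (fun hx => ⟨hx, ?_⟩)
    fun hx => ⟨hx, ?_⟩⟩
  · have : f x - t * 1 ≤ M * g x := h₂ x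
    rw [hx] at this
    linarith
  · have : -(M * (1 - g x)) ≤ f x - t * 1 := h₁ x
    rw [hx] at this
    linarith

theorem exists_isLUB_range [CompleteSpace A] (hι : b.IsFunctionRep a ι) (hb : b.IsSpectral)
    {g : ℕ → C(X, ℝ)} (hg : ∀ n, ι (g n) ∈ b.projBicommutant a) :
    ∃ k, ι k ∈ b.projBicommutant a ∧ IsLUB (Set.range g) k := by
  obtain ⟨s, hs, hlub⟩ := exists_mem_projBicommutant_le_iff_forall_le hb hg
  obtain ⟨k, rfl⟩ := hι.exists_apply_eq ((mem_projBicommutant_iff_mem_bicommutant hb.2).1 hs).2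
  refine ⟨k, hs, Set.forall_mem_range.2 fun n =>
    (hι.le_iff_le _ _).1 ((hlub _ hs.1).1 le_rfl n), fun y hy => ?_⟩
  have hgy : ∀ n, g n ≤ y := fun n => hy (Set.mem_range_self n)
  have hk := hι.mem_effects_iff.1 (effect_of_mem hs.1)
  have hg₀ : ∀ n, 0 ≤ g n := fun n => (hι.mem_effects_iff.1 (effect_of_mem (hg n).1)).1
  -- the excess of `k` over `y` lives where all `g n` vanish
  have hexcess : ∀ n, k - k ⊓ y ≤ 1 - g n := fun n x => by
    change k x - min (k x) (y x) ≤ 1 - g n x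
    have hkx : k x ≤ 1 := hk.2 x
    have hyx : g n x ≤ y x := hgy n x
    have hkx₀ : 0 ≤ k x := hk.1 x
    rcases hι.eq_zero_or_eq_one_of_mem_proj (hg n).1 x with h | h <;> rw [h] at hyx ⊢
    · linarith [le_min hkx₀ hyx]
    · rw [min_eq_left (hkx.trans hyx)]
      linarith
  have hzero : ι (k - k ⊓ y) = 0 := by
    refine eq_zero_of_le_of_forall_le_compl hb.1 (fun n => (hg n).1) hs.1 hlub
      (hι.nonneg_iff.2 (sub_nonneg.2 inf_le_left)) ((hι.le_iff_le _ _).2 ?_) fun n => ?_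
    · exact sub_le_self _ (le_inf hk.1 ((hg₀ 0).trans (hgy 0)))
    · rw [← hι.map_one, ← map_sub, hι.le_iff_le]
      exact hexcess n
  have hle : k - k ⊓ y ≤ 0 := (hι.le_iff_le _ _).1 (by rw [hzero, map_zero])
  exact (sub_nonpos.1 hle).trans inf_le_right

end Spectral

section BorelCalculus

variable {A : Type*} [NormedAddCommGroup A] [NormedSpace ℝ A] [PartialOrder A]
  [IsOrderedAddMonoid A] [IsOrderedModule ℝ A] [One A] [OrderUnitSpace A] [CompleteSpace A]
  {b : CompressionBase A} {a : A} {X : Type*} [TopologicalSpace X] [CompactSpace X] [T2Space X]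
  {ι : C(X, ℝ) →ₗ[ℝ] A} {f : C(X, ℝ)} {S : Set ℝ}

theorem exists_eventuallyEq_indicator_iUnion (hι : b.IsFunctionRep a ι) (hb : b.IsSpectral)
    {E : ℕ → Set X} {g : ℕ → C(X, ℝ)} (hg : ∀ n, ι (g n) ∈ b.projBicommutant a)
    (hE : ∀ n, g n =ᶠ[residual X] (E n).indicator 1) :
    ∃ k, ι k ∈ b.projBicommutant a ∧ k =ᶠ[residual X] (⋃ n, E n).indicator 1 := by
  obtain ⟨k, hk, hlub⟩ := hι.exists_isLUB_range hb hg
  refine ⟨k, hk, ?_⟩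
  filter_upwards [isLUB_continuousMap_iff.1 hlub, eventually_countable_forall.2 hE] with x hx hEx
  rw [← Set.range_comp] at hx
  refine hx.unique ?_
  simp only [Function.comp_def, hEx]
  by_cases hxE : x ∈ ⋃ n, E n
  · obtain ⟨n, hn⟩ := Set.mem_iUnion.1 hxE
    rw [Set.indicator_of_mem hxE]
    exact IsGreatest.isLUB ⟨⟨n, Set.indicator_of_mem hn _⟩, Set.forall_mem_range.2 fun m =>
      Set.indicator_le_self' (fun _ _ => zero_le_one) x⟩
  · have hn : ∀ n, x ∉ E n := fun n hn => hxE (Set.mem_iUnion_of_mem n hn)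
    simp only [Set.indicator_of_notMem hxE, Set.indicator_of_notMem (hn _), Set.range_const]
    exact isLUB_singleton

/-- The σ-algebra of the subsets of `X` that coincide, up to a meagre set, with a clopen set whose
characteristic function represents a projection in `P(a)`. -/
@[reducible]
def measurableSpace (hι : b.IsFunctionRep a ι) (hb : b.IsSpectral) : MeasurableSpace X where
  MeasurableSet' E := ∃ g, ι g ∈ b.projBicommutant a ∧ g =ᶠ[residual X] E.indicator 1
  measurableSet_empty :=
    ⟨0, (map_zero ι).symm ▸ zero_mem_projBicommutant hb.2 a, by
      rw [Set.indicator_empty]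
      rfl⟩
  measurableSet_compl := fun E ⟨g, hg, hgE⟩ =>
    ⟨1 - g, by
      rw [map_sub, hι.map_one]
      exact compl_mem_projBicommutant hg, by
      rw [Set.indicator_compl]
      exact EventuallyEq.rfl.sub hgE⟩
  measurableSet_iUnion E hE := by
    choose g hg hgE using hE
    exact hι.exists_eventuallyEq_indicator_iUnion hb hg hgE

theorem measurable_continuousMap (hι : b.IsFunctionRep a ι) (hb : b.IsSpectral) (f : C(X, ℝ)) :
    @Measurable X ℝ (hι.measurableSpace hb) _ f := by
  let _ := hι.measurableSpace hb
  choose g hga hg using hι.exists_spectralProjection hb.2 f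
  have hmeas : ∀ t, MeasurableSet (g t ⁻¹' {1}) := fun t => by
    refine ⟨g t, hga t, .of_forall fun x => ?_⟩
    rcases hι.eq_zero_or_eq_one_of_mem_proj (hga t).1 x with hx | hx <;> simp [hx]
  refine measurable_of_Ioi fun t => ?_
  have hUnion : f ⁻¹' Set.Ioi t = ⋃ n : ℕ, g (t + 1 / (n + 1)) ⁻¹' {1} := by
    ext x
    simp only [Set.mem_preimage, Set.mem_Ioi, Set.mem_iUnion, Set.mem_singleton_iff]
    constructor
    · intro hx
      obtain ⟨n, hn⟩ := exists_nat_one_div_lt (sub_pos.2 hx)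
      refine ⟨n, ((hg (t + 1 / (n + 1)) x).resolve_left fun h => ?_).1⟩
      linarith [h.2]
    · rintro ⟨n, hn⟩
      have hle := ((hg (t + 1 / (n + 1)) x).resolve_left fun h => zero_ne_one (h.1.symm.trans hn)).2
      exact (lt_add_of_pos_right t Nat.one_div_pos_of_nat).trans_le hle
  rw [hUnion]
  exact .iUnion fun n => hmeas _

theorem comp_mem_residuallyContinuous (hι : b.IsFunctionRep a ι) (hb : b.IsSpectral)
    (hS : ∀ x, f x ∈ S) (h : boundedBorel S) :
    (fun x => h.1 ⟨f x, hS x⟩) ∈ residuallyContinuous X := by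
  let _ := hι.measurableSpace hb
  obtain ⟨M, hM⟩ := h.2.2
  refine mem_residuallyContinuous_of_measurable ?_
    (h.2.1.comp (hι.measurable_continuousMap hb f).subtype_mk) fun x => hM ⟨f x, hS x⟩
  exact fun E ⟨g, _, hg⟩ => ⟨g, hg⟩

/-- The composition `h ↦ h ∘ f` of the bounded Borel functions with a continuous function
`f`, where `S` is any set containing the range of `f`. -/
def borelComp (hι : b.IsFunctionRep a ι) (hb : b.IsSpectral) (hS : ∀ x, f x ∈ S) :
    boundedBorel S →ₗ[ℝ] residuallyContinuous X where
  toFun h := ⟨_, hι.comp_mem_residuallyContinuous hb hS h⟩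
  map_add' _ _ := rfl
  map_smul' _ _ := rfl

/-- The Borel functional calculus `h ↦ h(a)`, where `ι f = a`: the element of `CC(a)` represented
by the continuous function that agrees with `h ∘ f` off a meagre set. -/
noncomputable def borelCalculus (hι : b.IsFunctionRep a ι) (hb : b.IsSpectral)
    (hS : ∀ x, f x ∈ S) : boundedBorel S →ₗ[ℝ] A :=
  ι ∘ₗ residualRep ∘ₗ hι.borelComp hb hS

variable (hι : b.IsFunctionRep a ι) (hb : b.IsSpectral) (hS : ∀ x, f x ∈ S)

theorem borelCalculus_mem (h : boundedBorel S) : hι.borelCalculus hb hS h ∈ b.bicommutant a :=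
  hι.apply_mem _

theorem borelCalculus_eq {h : boundedBorel S} {g : C(X, ℝ)}
    (hg : ∀ᶠ x in residual X, g x = h.1 ⟨f x, hS x⟩) : hι.borelCalculus hb hS h = ι g :=
  congrArg ι (residualRep_eq_of_eventuallyEq hg)

theorem borelCalculus_nonneg {h : boundedBorel S} (hh : ∀ t, 0 ≤ h.1 t) :
    0 ≤ hι.borelCalculus hb hS h :=
  hι.nonneg_iff.2 <| continuousMap_le_of_eventually_residual <|
    (residualRep_eventuallyEq (hι.borelComp hb hS h)).mono fun x hx =>
      (hh ⟨f x, hS x⟩).trans_eq hx.symm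

theorem borelCalculus_one : hι.borelCalculus hb hS 1 = 1 :=
  (hι.borelCalculus_eq hb hS (g := 1) (.of_forall fun _ => rfl)).trans hι.map_one

theorem borelCalculus_id (hf : ι f = a) (hid : (fun t : S => (t : ℝ)) ∈ boundedBorel S) :
    hι.borelCalculus hb hS ⟨_, hid⟩ = a :=
  (hι.borelCalculus_eq hb hS (.of_forall fun _ => rfl)).trans hf

theorem borelCalculus_char_mem {B : Set S} (hB : MeasurableSet B) :
    hι.borelCalculus hb hS (boundedBorel.char B hB) ∈ b.projBicommutant a := by
  let _ := hι.measurableSpace hb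
  obtain ⟨g, hg, hgB⟩ : MeasurableSet ((fun x => (⟨f x, hS x⟩ : S)) ⁻¹' B) :=
    (hι.measurable_continuousMap hb f).subtype_mk hB
  rwa [hι.borelCalculus_eq hb hS (h := boundedBorel.char B hB) (g := g) hgB]

theorem isLUB_borelCalculus {T : Set (boundedBorel S)} (hT : T.Countable) {h : boundedBorel S}
    (hh : ∀ t, IsLUB ((fun g : boundedBorel S => g.1 t) '' T) (h.1 t)) :
    IsLUB ((fun g => (⟨_, hι.borelCalculus_mem hb hS g⟩ : b.bicommutant a)) '' T)
      ⟨_, hι.borelCalculus_mem hb hS h⟩ := by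
  have hlub := isLUB_residualRep (hT.image (hι.borelComp hb hS))
    (u := hι.borelComp hb hS h) fun x => by
      rw [Set.image_image]
      exact hh ⟨f x, hS x⟩
  have := hι.orderIso.isLUB_image'.2 hlub
  rwa [Set.image_image, Set.image_image] at this

theorem isLUB_borelCalculus_max (h₁ h₂ : boundedBorel S) :
    IsLUB ({⟨_, hι.borelCalculus_mem hb hS h₁⟩, ⟨_, hι.borelCalculus_mem hb hS h₂⟩} :
      Set (b.bicommutant a)) ⟨_, hι.borelCalculus_mem hb hS (boundedBorel.max h₁ h₂)⟩ := by
  simpa only [Set.image_pair] using hι.isLUB_borelCalculus hb hS (T := {h₁, h₂})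
    (Set.toFinite _).countable fun t => by
      rw [Set.image_pair]
      exact isLUB_pair

theorem isLUB_range_borelCalculus {h' : ℕ → boundedBorel S} {h : boundedBorel S}
    (hh : ∀ t, IsLUB (Set.range fun n => (h' n).1 t) (h.1 t)) :
    IsLUB (Set.range fun n => (⟨_, hι.borelCalculus_mem hb hS (h' n)⟩ : b.bicommutant a))
      ⟨_, hι.borelCalculus_mem hb hS h⟩ := by
  have := hι.isLUB_borelCalculus hb hS (Set.countable_range h') fun t => by
    rw [← Set.range_comp]
    exact hh t
  rwa [← Set.range_comp] at this

end BorelCalculus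

end IsFunctionRep

end CompressionBase

theorem coe_mem_boundedBorel {S : Set ℝ} (hS : Bornology.IsBounded S) :
    (fun t : S => (t : ℝ)) ∈ boundedBorel S :=
  have ⟨M, hM⟩ := hS.exists_norm_le
  ⟨measurable_subtype_coe, M, fun t => hM t t.2⟩

theorem theorem4p3 {A : Type u} [NormedAddCommGroup A] [NormedSpace ℝ A] [PartialOrder A]
    [IsOrderedAddMonoid A] [IsOrderedModule ℝ A] [One A] [OrderUnitSpace A] [CompleteSpace A]
    (b : CompressionBase A) (hb : b.IsSpectral) (a : A) :
    -- `CC(a)` is isomorphic to some `C(X, ℝ)`, and the spectrum is the range of the function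
    -- corresponding to `a` in any such isomorphism
    (∃ (X : Type u) (_ : TopologicalSpace X) (_ : CompactSpace X) (_ : T2Space X)
      (_ : TotallyDisconnectedSpace X) (ι : C(X, ℝ) →ₗ[ℝ] A) (f : C(X, ℝ)),
      b.IsFunctionRep a ι ∧ ι f = a) ∧
    (∀ (X : Type u) [TopologicalSpace X] [CompactSpace X] [T2Space X]
      [TotallyDisconnectedSpace X] (ι : C(X, ℝ) →ₗ[ℝ] A) (f : C(X, ℝ)),
      b.IsFunctionRep a ι → ι f = a → b.spectrum a = Set.range f) ∧
    -- the Borel functional calculus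
    ∃ (Ψ : boundedBorel (b.spectrum a) →ₗ[ℝ] A) (hΨ : ∀ h, Ψ h ∈ b.bicommutant a),
      (∀ h : boundedBorel (b.spectrum a), (∀ t, 0 ≤ h.1 t) → 0 ≤ Ψ h) ∧
      Ψ 1 = 1 ∧
      (∃ hid : (fun t : b.spectrum a => (t : ℝ)) ∈ boundedBorel (b.spectrum a),
        Ψ ⟨fun t => (t : ℝ), hid⟩ = a) ∧
      (∀ (B : Set (b.spectrum a)) (hB : MeasurableSet B),
        Ψ (boundedBorel.char B hB) ∈ b.projBicommutant a) ∧
      (∀ h₁ h₂ : boundedBorel (b.spectrum a),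
        IsLUB ({⟨Ψ h₁, hΨ h₁⟩, ⟨Ψ h₂, hΨ h₂⟩} : Set (b.bicommutant a))
          ⟨Ψ (boundedBorel.max h₁ h₂), hΨ _⟩) ∧
      (∀ (h' : ℕ → boundedBorel (b.spectrum a)) (h : boundedBorel (b.spectrum a)),
        (∀ n t, (h' n).1 t ≤ (h' (n + 1)).1 t) →
        (∀ t, IsLUB (Set.range fun n => (h' n).1 t) (h.1 t)) →
        IsLUB (Set.range fun n => (⟨Ψ (h' n), hΨ (h' n)⟩ : b.bicommutant a)) ⟨Ψ h, hΨ h⟩) := by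
  obtain ⟨X, _, _, _, _, ι, hι⟩ := b.exists_isFunctionRep hb.2 a
  obtain ⟨f, hf⟩ := hι.exists_apply_eq (b.self_mem_bicommutant hb.2 a)
  have hspec : b.spectrum a = Set.range f := hι.spectrum_eq_range hf
  have hS : ∀ x, f x ∈ b.spectrum a := fun x => hspec ▸ Set.mem_range_self x
  have hbdd : Bornology.IsBounded (b.spectrum a) :=
    hspec ▸ (isCompact_range f.continuous).isBounded
  have hid := coe_mem_boundedBorel hbdd
  exact ⟨⟨X, _, ‹_›, ‹_›, ‹_›, ι, f, hι, hf⟩,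
    fun Y _ _ _ _ κ g hκ hg => hκ.spectrum_eq_range hg,
    hι.borelCalculus hb hS, hι.borelCalculus_mem hb hS,
    fun h hh => hι.borelCalculus_nonneg hb hS hh,
    hι.borelCalculus_one hb hS,
    ⟨hid, hι.borelCalculus_id hb hS hf hid⟩,
    fun B hB => hι.borelCalculus_char_mem hb hS hB,
    hι.isLUB_borelCalculus_max hb hS,
    fun h' h _ hh => hι.isLUB_range_borelCalculus hb hS hh⟩
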